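/- Let $R$ be an integer with $|R|>1$, let $B\subset\mathbb{Z}$ be a finite set with $0\in B$ and $|B|=N$, and let $\mu_B$ be the invariant measure of the iterated function system $\tau_b(x)=R^{-1}(x+b)$, $b\in B$, on $\mathbb{R}$, i.e. the unique Borel probability measure with $\int f\,d\mu_B=\frac1N\sum_{b\in B}\int f\circ\tau_b\,d\mu_B$ for all bounded Borel functions $f$. Let $l_0,\dots,l_{N-1}\in\mathbb{Z}$ with $l_0=0$ be such that the matrix $$\frac{1}{\sqrt N}\left(e^{2\pi i R^{-1}b\, l_i}\right)_{i\in\{0,\dots,N-1\},\,b\in B}$$ is unitary. Put $e_t(x)=e^{2\pi i t x}$, $m_B(t)=\frac1N\sum_{b\in B}e^{2\pi i b t}$, $g_i(t)=R^{-1}(t-l_i)$ and $\nu_i(t)=m_B(g_i(t))$ for $t,x\in\mathbb{R}$. For a finite (possibly empty) word $\omega=\omega_1\dots\omega_n$ over $\{0,\dots,N-1\}$ put $g_\omega=g_{\omega_n}\circ\dots\circ g_{\omega_1}$ and $\nu_\omega(t)=\prod_{k=1}^{n}\nu_{\omega_k}(g_{\omega_1\dots\omega_{k-1}}(t))$. A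 set $M\subseteq\mathbb{R}$ is invariant if $g_i(t)\in M$ whenever $t\in M$ and $\nu_i(t)\neq0$; a minimal invariant set is a nonempty invariant set that has no nonempty proper invariant subset. A nonempty word $\beta$ is a cycle word for $c\in\mathbb{R}$ if $g_\beta(c)=c$, $\nu_\beta(c)\neq0$, and $g_\gamma(c)\neq c$ for every nonempty proper initial subword $\gamma$ of $\beta$. Let $\Omega_c^{(0)}$ be the set of all finite words (including the empty word) that do not end in a cycle word for $c$. Then there are only finitely many minimal invariant sets $M_1,\dots,M_p$, and for every choice of points $c_j\in M_j$, $j=1,\dots,p$, the family of exponential functions $$\left\{e_{l_{\omega_1}+R l_{\omega_2}+\dots+R^{n-1}l_{\omega_n}+R^n c_j} : \omega=\omega_1\dots\omega_n\in\Omega_{c_j}^{(0)},\ j=1,\dots,p\right\}$$ is an orthonormal basis of $L^2(\mu_B)$. -/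

import Mathlib

open MeasureTheory

namespace FractalFourier

noncomputable section

/-! ### The affine iterated function system and its invariant measure -/

/-- The maps `τ_b(x) = R⁻¹ (x + b)` of the iterated function system on `ℝ`. -/
def tau (R b : ℤ) (x : ℝ) : ℝ := (x + b) / R

/-- `μ` is an invariant Borel probability measure of the system `(τ_b)_{b ∈ B}`:
`∫ f dμ = (1/N) ∑_{b ∈ B} ∫ f ∘ τ_b dμ` for all bounded Borel functions `f`, with `N = |B|`. -/
structure IsInvariantMeasure (R : ℤ) (B : Finset ℤ) (μ : Measure ℝ) : Prop where
  isProbabilityMeasure : IsProbabilityMeasure μ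
  integral_eq : ∀ f : ℝ → ℂ, Measurable f → (∃ C : ℝ, ∀ x, ‖f x‖ ≤ C) →
    ∫ x, f x ∂μ = (1 / (B.card : ℂ)) * ∑ b ∈ B, ∫ x, f (tau R b x) ∂μ

/-- The invariant measure `μ_B`: the unique invariant Borel probability measure. Existence and
uniqueness (for `|R| > 1` and `B` nonempty) are `existsUnique_isInvariantMeasure`. -/
def invariantMeasure (R : ℤ) (B : Finset ℤ) : Measure ℝ :=
  Classical.epsilon (IsInvariantMeasure R B)

/-! ### Exponentials, transition weights and words -/

/-- The exponential function `e_t(x) = e^{2π i t x}`. -/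
def expFun (t x : ℝ) : ℂ := Complex.exp (2 * Real.pi * Complex.I * t * x)

/-- The matrix `N^{-1/2} (e^{2π i R⁻¹ b l_i})`, with rows `i = 0, …, N - 1` and columns `b ∈ B`. -/
def hadamardMatrix {N : ℕ} (R : ℤ) (B : Finset ℤ) (l : Fin N → ℤ) : Matrix (Fin N) B ℂ :=
  fun i b => (1 / (Real.sqrt N : ℂ)) *
    Complex.exp (2 * Real.pi * Complex.I * ((R : ℂ)⁻¹ * ((b : ℤ) : ℂ) * (l i : ℂ)))

/-- `m_B(t) = (1/N) ∑_{b ∈ B} e^{2π i b t}`. -/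
def mB (B : Finset ℤ) (t : ℝ) : ℂ :=
  (1 / (B.card : ℂ)) * ∑ b ∈ B, expFun b t

/-- The maps `g_i(t) = R⁻¹ (t - l_i)`. -/
def g {N : ℕ} (R : ℤ) (l : Fin N → ℤ) (i : Fin N) (t : ℝ) : ℝ := (t - l i) / R

/-- The weights `ν_i(t) = m_B(g_i(t))`; the transition from `t` to `g_i(t)` is possible when
`ν_i(t) ≠ 0`. -/
def nu {N : ℕ} (R : ℤ) (B : Finset ℤ) (l : Fin N → ℤ) (i : Fin N) (t : ℝ) : ℂ :=
  mB B (g R l i t)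

/-- `g_ω = g_{ω_n} ∘ ⋯ ∘ g_{ω_1}` for a finite word `ω = ω_1 … ω_n`. -/
def gWord {N : ℕ} (R : ℤ) (l : Fin N → ℤ) : List (Fin N) → ℝ → ℝ
  | [], t => t
  | i :: ω, t => gWord R l ω (g R l i t)

/-- `ν_ω(t) = ν_{ω_1}(t) ν_{ω_2}(g_{ω_1}(t)) ⋯ ν_{ω_n}(g_{ω_{n-1}} ⋯ g_{ω_1}(t))`. -/
def nuWord {N : ℕ} (R : ℤ) (B : Finset ℤ) (l : Fin N → ℤ) : List (Fin N) → ℝ → ℂ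
  | [], _ => 1
  | i :: ω, t => nu R B l i t * nuWord R B l ω (g R l i t)

/-- A set is invariant if it contains the endpoint of every possible transition from its points. -/
def IsInvariant {N : ℕ} (R : ℤ) (B : Finset ℤ) (l : Fin N → ℤ) (M : Set ℝ) : Prop :=
  ∀ t ∈ M, ∀ i, nu R B l i t ≠ 0 → g R l i t ∈ M

/-- Minimal invariant sets: minimal among the nonempty invariant subsets of `ℝ`. -/
def IsMinimalInvariant {N : ℕ} (R : ℤ) (B : Finset ℤ) (l : Fin N → ℤ) (M : Set ℝ) : Prop :=
  Minimal (fun M' : Set ℝ => M'.Nonempty ∧ IsInvariant R B l M') M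

/-- `β` is a cycle word for `c`: it is nonempty, `g_β(c) = c`, no nonempty proper initial part of
`β` takes `c` back to `c`, and `ν_β(c) ≠ 0`. -/
def IsCycleWord {N : ℕ} (R : ℤ) (B : Finset ℤ) (l : Fin N → ℤ) (c : ℝ)
    (β : List (Fin N)) : Prop :=
  β ≠ [] ∧ gWord R l β c = c ∧
    (∀ γ : List (Fin N), γ <+: β → γ ≠ [] → γ ≠ β → gWord R l γ c ≠ c) ∧
    nuWord R B l β c ≠ 0

/-- `Ω_c^{(0)}`: the finite words that do not end in a cycle word for `c`. -/
def OmegaZero {N : ℕ} (R : ℤ) (B : Finset ℤ) (l : Fin N → ℤ) (c : ℝ) : Set (List (Fin N)) :=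
  {ω | ∀ β, IsCycleWord R B l c β → ¬ β <:+ ω}

/-- The frequency `l_{ω_1} + R l_{ω_2} + ⋯ + R^{n-1} l_{ω_n} + R^n c` of a word
`ω = ω_1 … ω_n`. -/
def freq {N : ℕ} (R : ℤ) (l : Fin N → ℤ) (c : ℝ) (ω : List (Fin N)) : ℝ :=
  ∑ k : Fin ω.length, (R : ℝ) ^ (k : ℕ) * (l (ω.get k) : ℝ) + (R : ℝ) ^ ω.length * c

/-! ### Existence and uniqueness of the invariant measure -/

lemma measurable_tau (R b : ℤ) : Measurable (tau R b) := by
  unfold tau; fun_prop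

/-- Prepend a digit to a sequence of digits. -/
def consSeq {B : Type*} (p : B × (ℕ → B)) : ℕ → B
  | 0 => p.1
  | n + 1 => p.2 n

lemma measurable_consSeq {B : Type*} [MeasurableSpace B] :
    Measurable (consSeq : B × (ℕ → B) → ℕ → B) := by
  rw [measurable_pi_iff]
  rintro (_ | n)
  · exact measurable_fst
  · exact (measurable_pi_apply n).comp measurable_snd

lemma map_consSeq {B : Type*} [MeasurableSpace B] (u : Measure B) [IsProbabilityMeasure u] :
    (u.prod (Measure.infinitePi fun _ : ℕ => u)).map consSeq =
      Measure.infinitePi fun _ : ℕ => u := by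
  classical
  refine Measure.eq_infinitePi (fun _ : ℕ => u) fun s t ht => ?_
  let t' : ℕ → Set B := fun i => if i ∈ s then t i else Set.univ
  have ht' : ∀ i, MeasurableSet (t' i) := fun i => by
    by_cases h : i ∈ s <;> simp [t', h, ht]
  obtain ⟨n, hn⟩ : ∃ n, s ⊆ Finset.range (n + 1) :=
    ⟨s.sup id, fun i hi => Finset.mem_range.2 (Nat.lt_succ_of_le (Finset.le_sup (f := id) hi))⟩
  have hpre : consSeq ⁻¹' (Set.pi s t) =
      t' 0 ×ˢ Set.pi (Finset.range n : Set ℕ) (fun i => t' (i + 1)) := by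
    ext p
    simp only [Set.mem_preimage, Set.mem_pi, Set.mem_prod, Finset.mem_coe, Finset.mem_range]
    constructor
    · intro h
      refine ⟨?_, fun i _ => ?_⟩
      · by_cases h0 : 0 ∈ s
        · simpa [t', h0, consSeq] using h 0 h0
        · simp [t', h0]
      · by_cases h0 : i + 1 ∈ s
        · simpa [t', h0, consSeq] using h (i + 1) h0
        · simp [t', h0]
    · rintro ⟨h1, h2⟩ (_ | i) hi
      · simpa [t', hi, consSeq] using h1
      · have := h2 i (by have := Finset.mem_range.1 (hn hi); omega)
        simpa [t', hi, consSeq] using this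
  rw [Measure.map_apply measurable_consSeq (MeasurableSet.pi s.countable_toSet fun i _ => ht i),
    hpre, Measure.prod_prod, Measure.infinitePi_pi _ (fun i _ => ht' _)]
  have h1 : ∏ i ∈ s, u (t i) = ∏ i ∈ Finset.range (n + 1), u (t' i) := by
    rw [← Finset.prod_subset hn]
    · exact Finset.prod_congr rfl fun i hi => by simp [t', hi]
    · intro i _ hi; simp [t', hi]
  rw [h1, Finset.prod_range_succ', mul_comm]

/-- The point `∑_{k ≥ 1} R^{-k} b_k` of the attractor with the digits `b_1, b_2, …`. -/
def digitSum (R : ℤ) (B : Finset ℤ) (ω : ℕ → B) : ℝ := ∑' k, ((ω k : ℤ) : ℝ) / (R : ℝ) ^ (k + 1)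

lemma digitSum_bound {R : ℤ} (hR : 1 < |R|) (B : Finset ℤ) :
    ∃ u : ℕ → ℝ, Summable u ∧
      ∀ k (ω : ℕ → B), ‖((ω k : ℤ) : ℝ) / (R : ℝ) ^ (k + 1)‖ ≤ u k := by
  have hR' : 1 < |(R : ℝ)| := by exact_mod_cast hR
  refine ⟨fun k => (∑ b ∈ B, |(b : ℝ)|) * (|(R : ℝ)|⁻¹) ^ (k + 1), ?_, fun k ω => ?_⟩
  · refine Summable.mul_left _ ?_
    exact (summable_nat_add_iff 1).2
      (summable_geometric_of_lt_one (by positivity) (inv_lt_one_of_one_lt₀ hR'))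
  · rw [norm_div, norm_pow, Real.norm_eq_abs, Real.norm_eq_abs, div_eq_mul_inv, ← inv_pow]
    refine mul_le_mul_of_nonneg_right ?_ (by positivity)
    exact Finset.single_le_sum (f := fun b : ℤ => |(b : ℝ)|) (fun _ _ => abs_nonneg _) (ω k).2

lemma measurable_digitSum {R : ℤ} (hR : 1 < |R|) (B : Finset ℤ) : Measurable (digitSum R B) := by
  obtain ⟨u, hu, hb⟩ := digitSum_bound hR B
  refine Continuous.measurable (continuous_tsum (fun k => ?_) hu hb)
  refine Continuous.div_const ?_ _
  exact (continuous_of_discreteTopology (f := fun b : B => ((b : ℤ) : ℝ))).comp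
    (continuous_apply k)

lemma digitSum_consSeq {R : ℤ} (hR : 1 < |R|) (B : Finset ℤ) (b : B) (ω : ℕ → B) :
    digitSum R B (consSeq (b, ω)) = tau R b (digitSum R B ω) := by
  obtain ⟨u, hu, hb⟩ := digitSum_bound hR B
  have hs : ∀ ω : ℕ → B, Summable fun k => ((ω k : ℤ) : ℝ) / (R : ℝ) ^ (k + 1) :=
    fun ω => Summable.of_norm_bounded hu fun k => hb k ω
  have hR0 : (R : ℝ) ≠ 0 := by
    rintro h
    have : R = 0 := by exact_mod_cast h
    simp [this] at hR
  unfold digitSum tau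
  rw [(hs _).tsum_eq_zero_add, add_div, add_comm, ← tsum_div_const]
  congr 1
  · refine tsum_congr fun k => ?_
    simp only [consSeq]
    rw [pow_succ _ (k + 1), div_div]
  · simp [consSeq]

lemma exists_isInvariantMeasure {R : ℤ} (hR : 1 < |R|) {B : Finset ℤ} (hB : B.Nonempty) :
    ∃ μ, IsInvariantMeasure R B μ := by
  have : Nonempty B := hB.to_subtype
  let u : Measure B := (PMF.uniformOfFintype B).toMeasure
  let P : Measure (ℕ → B) := Measure.infinitePi fun _ : ℕ => u
  have hX := measurable_digitSum hR B
  refine ⟨P.map (digitSum R B), Measure.isProbabilityMeasure_map hX.aemeasurable, ?_⟩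
  rintro f hf ⟨C, hC⟩
  have hm : ∀ b : ℤ, Measurable fun x => f (tau R b x) := fun b => hf.comp (measurable_tau R b)
  rw [integral_map hX.aemeasurable hf.aestronglyMeasurable]
  simp_rw [fun b : ℤ => integral_map (μ := P) hX.aemeasurable (hm b).aestronglyMeasurable]
  have hP : P = (u.prod P).map consSeq := (map_consSeq u).symm
  have hfX : Measurable fun ω => f (digitSum R B ω) := hf.comp hX
  calc ∫ ω, f (digitSum R B ω) ∂P
      = ∫ ω, f (digitSum R B ω) ∂((u.prod P).map consSeq) := by rw [← hP]
    _ = ∫ p, f (digitSum R B (consSeq p)) ∂(u.prod P) :=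
        integral_map measurable_consSeq.aemeasurable hfX.aestronglyMeasurable
    _ = ∫ b, ∫ ω, f (digitSum R B (consSeq (b, ω))) ∂P ∂u :=
        integral_prod _ (Integrable.of_bound
          (hfX.comp measurable_consSeq).aestronglyMeasurable C (.of_forall fun _ => hC _))
    _ = ∫ b : B, ∫ ω, f (tau R b (digitSum R B ω)) ∂P ∂u := by
        simp_rw [digitSum_consSeq hR]
    _ = (1 / (B.card : ℂ)) * ∑ b ∈ B, ∫ ω, f (tau R b (digitSum R B ω)) ∂P := by
        rw [PMF.integral_eq_sum, Finset.mul_sum,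
          ← Finset.sum_coe_sort B fun b => (1 / (B.card : ℂ)) *
            ∫ ω, f (tau R b (digitSum R B ω)) ∂P]
        refine Finset.sum_congr rfl fun b _ => ?_
        simp [PMF.uniformOfFintype_apply]

lemma IsInvariantMeasure.charFun_eq {R : ℤ} {B : Finset ℤ} {μ : Measure ℝ}
    (h : IsInvariantMeasure R B μ) (t : ℝ) :
    charFun μ t = (1 / (B.card : ℂ)) *
      ∑ b ∈ B, Complex.exp ((t / R * b : ℝ) * Complex.I) * charFun μ (t / R) := by
  rw [charFun_apply_real, h.integral_eq (fun x => Complex.exp (t * x * Complex.I))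
    (by fun_prop) ⟨1, fun x => by
      rw [← Complex.ofReal_mul, Complex.norm_exp_ofReal_mul_I]⟩]
  congr 1
  refine Finset.sum_congr rfl fun b _ => ?_
  rw [charFun_apply_real, ← integral_const_mul]
  refine integral_congr_ae (.of_forall fun x => ?_)
  simp only [tau]
  rw [← Complex.exp_add]
  congr 1
  push_cast
  ring

lemma IsInvariantMeasure.unique {R : ℤ} (hR : 1 < |R|) {B : Finset ℤ} (hB : B.Nonempty)
    {μ ν : Measure ℝ} (hμ : IsInvariantMeasure R B μ) (hν : IsInvariantMeasure R B ν) :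
    μ = ν := by
  have := hμ.isProbabilityMeasure
  have := hν.isProbabilityMeasure
  have hR' : 1 < |(R : ℝ)| := by exact_mod_cast hR
  have hN : (0 : ℝ) < B.card := by exact_mod_cast hB.card_pos
  refine Measure.ext_of_charFun (funext fun t => ?_)
  have step : ∀ t, ‖charFun μ t - charFun ν t‖ ≤ ‖charFun μ (t / R) - charFun ν (t / R)‖ := by
    intro t
    rw [hμ.charFun_eq t, hν.charFun_eq t, ← mul_sub, ← Finset.sum_sub_distrib, norm_mul]
    simp_rw [← mul_sub]
    have h1 : ‖∑ b ∈ B, Complex.exp ((t / R * b : ℝ) * Complex.I) *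
        (charFun μ (t / R) - charFun ν (t / R))‖ ≤
        B.card * ‖charFun μ (t / R) - charFun ν (t / R)‖ := by
      refine (norm_sum_le _ _).trans (le_of_eq ?_)
      simp only [norm_mul, Complex.norm_exp_ofReal_mul_I, one_mul, Finset.sum_const, nsmul_eq_mul]
    refine (mul_le_mul_of_nonneg_left h1 (norm_nonneg _)).trans (le_of_eq ?_)
    rw [norm_div, norm_one, Complex.norm_natCast]
    field_simp
  have iter : ∀ n : ℕ, ‖charFun μ t - charFun ν t‖ ≤
      ‖charFun μ (t * ((R : ℝ)⁻¹) ^ n) - charFun ν (t * ((R : ℝ)⁻¹) ^ n)‖ := by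
    intro n
    induction n with
    | zero => simp
    | succ n ih =>
      refine ih.trans ((step _).trans (le_of_eq ?_))
      rw [div_eq_mul_inv, mul_assoc, ← pow_succ]
  have hlim : Filter.Tendsto (fun n : ℕ => t * ((R : ℝ)⁻¹) ^ n) Filter.atTop (nhds 0) := by
    have h := (tendsto_pow_atTop_nhds_zero_of_abs_lt_one (r := (R : ℝ)⁻¹)
      (by rw [abs_inv]; exact inv_lt_one_of_one_lt₀ hR')).const_mul t
    simpa using h
  have hc : Continuous fun t => ‖charFun μ t - charFun ν t‖ := by fun_prop
  have h0 := ge_of_tendsto' ((hc.tendsto 0).comp hlim) iter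
  simp only [charFun_zero, probReal_univ, sub_self, norm_zero] at h0
  exact sub_eq_zero.1 (norm_le_zero_iff.1 h0)

theorem existsUnique_isInvariantMeasure {R : ℤ} (hR : 1 < |R|) {B : Finset ℤ}
    (hB : B.Nonempty) : ∃! μ, IsInvariantMeasure R B μ := by
  obtain ⟨μ, hμ⟩ := exists_isInvariantMeasure hR hB
  exact ⟨μ, hμ, fun ν hν => hν.unique hR hB hμ⟩

theorem isInvariantMeasure_invariantMeasure {R : ℤ} (hR : 1 < |R|) {B : Finset ℤ}
    (hB : B.Nonempty) : IsInvariantMeasure R B (invariantMeasure R B) :=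
  Classical.epsilon_spec (exists_isInvariantMeasure hR hB)

end

end FractalFourier

open FractalFourier

/-!
Unitarity of the matrix gives `∑ |ν_i|² = 1` and, together with the invariance of `μ`, operators
`T_i` on `L²(μ)` with `T_i e_t = ν_i(t) e_{g_i(t)}` and `∑ T_i* T_i = 1`. A minimal invariant set is
a single cycle along which `|ν_i| = 1`, so its points lie in the dual lattice of `B`, where `m_B` is
periodic. The set `Γ` of all frequencies built on cycle points therefore satisfies
`Γ = ⋃ (l_i + R Γ)`, and for `s` in `Γ` one has `T_i e_{l_j + R s} = δ_ij e_s`. This yields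
orthogonality on `Γ` by descent in the size of `t - s`.

For completeness let `Q` be the projection onto the orthogonal complement of the span of `Γ`. It
commutes with the `T_i`, so `D(t) = ‖Q e_t‖²` solves `D = ∑ |ν_i|² D ∘ g_i` and vanishes at the
cycle points. The points of a compact interval where the maximum of `D` is attained form an
invariant set. If it is finite, it contains a cycle; if it is infinite, `D` is constant by
analyticity. In both cases `D = 0`.

Finally, every frequency in `Γ` has exactly one expansion based at a chosen point `c_j` of a cycle
whose word does not end in a cycle word for `c_j`.
-/

namespace FractalFourier

noncomputable section

open ComplexConjugate Topology

/-! ### Exponentials and the dual lattice of the digits -/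

lemma expFun_eq_fourierChar (t x : ℝ) : expFun t x = Real.fourierChar (t * x) := by
  rw [expFun, Real.fourierChar_apply]
  congr 1
  push_cast
  ring

lemma expFun_comm (t x : ℝ) : expFun t x = expFun x t := by
  simp only [expFun_eq_fourierChar, mul_comm]

@[simp] lemma norm_expFun (t x : ℝ) : ‖expFun t x‖ = 1 := by
  rw [expFun_eq_fourierChar, Circle.norm_coe]

@[simp] lemma expFun_zero_left (x : ℝ) : expFun 0 x = 1 := by simp [expFun]

@[simp] lemma expFun_zero_right (t : ℝ) : expFun t 0 = 1 := by simp [expFun]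

lemma expFun_add_left (s t x : ℝ) : expFun (s + t) x = expFun s x * expFun t x := by
  simp only [expFun_eq_fourierChar, add_mul, AddChar.map_add_eq_mul, Circle.coe_mul]

lemma expFun_add_right (t x y : ℝ) : expFun t (x + y) = expFun t x * expFun t y := by
  simp only [expFun_comm t, expFun_add_left]

lemma conj_expFun_left (t x : ℝ) : conj (expFun t x) = expFun (-t) x := by
  simp only [expFun_eq_fourierChar, neg_mul, AddChar.map_neg_eq_inv, Circle.coe_inv_eq_conj]

lemma conj_expFun_right (t x : ℝ) : conj (expFun t x) = expFun t (-x) := by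
  rw [expFun_comm, conj_expFun_left, expFun_comm]

@[fun_prop] lemma continuous_expFun (t : ℝ) : Continuous (expFun t) := by
  unfold expFun
  fun_prop

lemma expFun_eq_one_iff {t x : ℝ} : expFun t x = 1 ↔ ∃ k : ℤ, t * x = k := by
  have hpi : (2 * Real.pi * Complex.I : ℂ) ≠ 0 := Complex.two_pi_I_ne_zero
  rw [expFun, Complex.exp_eq_one_iff]
  refine exists_congr fun k => ?_
  rw [mul_assoc, mul_comm (k : ℂ), mul_right_inj' hpi]
  norm_cast

/-- The dual lattice `{t | b t ∈ ℤ for all b ∈ B}` of a set of digits, on which every `e_b` equals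
`1`. It is all of `ℝ` if `B ⊆ {0}`. -/
def dualLattice (B : Finset ℤ) : AddSubgroup ℝ where
  carrier := {t | ∀ b ∈ B, ∃ k : ℤ, b * t = k}
  zero_mem' := fun _ _ => ⟨0, by simp⟩
  add_mem' := fun hs ht b hb => by
    obtain ⟨k, hk⟩ := hs b hb
    obtain ⟨m, hm⟩ := ht b hb
    exact ⟨k + m, by push_cast; rw [mul_add, hk, hm]⟩
  neg_mem' := fun ht b hb => by
    obtain ⟨k, hk⟩ := ht b hb
    exact ⟨-k, by push_cast; rw [mul_neg, hk]⟩

section DualLattice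

variable {B : Finset ℤ} {s t : ℝ}

lemma intCast_mem_dualLattice (k : ℤ) : (k : ℝ) ∈ dualLattice B :=
  fun b _ => ⟨b * k, by push_cast; rfl⟩

lemma intCast_mul_mem_dualLattice (k : ℤ) (ht : t ∈ dualLattice B) :
    k * t ∈ dualLattice B := by
  rw [← zsmul_eq_mul]
  exact zsmul_mem ht k

lemma mB_zero (hB : B.Nonempty) : mB B 0 = 1 := by
  have : (B.card : ℂ) ≠ 0 := by exact_mod_cast hB.card_pos.ne'
  simp [mB, this]

lemma mB_add_of_mem (ht : t ∈ dualLattice B) (s : ℝ) : mB B (s + t) = mB B s := by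
  unfold mB
  congr 1
  refine Finset.sum_congr rfl fun b hb => ?_
  rw [expFun_add_right, expFun_eq_one_iff.2 (ht b hb), mul_one]

lemma mB_of_mem (hB : B.Nonempty) (ht : t ∈ dualLattice B) : mB B t = 1 := by
  rw [← zero_add t, mB_add_of_mem ht, mB_zero hB]

/-- Equality in the triangle inequality for `m_B(t)` forces all `e_b(t)` to agree with `e_0(t)`. -/
lemma mem_dualLattice_of_norm_mB_eq_one (hB : (0 : ℤ) ∈ B) (ht : ‖mB B t‖ = 1) :
    t ∈ dualLattice B := by
  intro b hb
  rcases eq_or_ne b 0 with rfl | hb0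
  · exact ⟨0, by simp⟩
  have hbB : b ∈ B.erase 0 := Finset.mem_erase.2 ⟨hb0, hb⟩
  have hsum : ‖∑ a ∈ B, expFun a t‖ = B.card := by
    have hN : (0 : ℝ) < B.card := by exact_mod_cast Finset.card_pos.2 ⟨0, hB⟩
    rw [mB, norm_mul, norm_div, norm_one, Complex.norm_natCast] at ht
    field_simp at ht
    exact ht
  have hsplit : ∑ a ∈ B, expFun a t
      = 1 + expFun b t + ∑ a ∈ (B.erase 0).erase b, expFun a t := by
    rw [← Finset.add_sum_erase _ _ hB, ← Finset.add_sum_erase _ _ hbB, Int.cast_zero,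
      expFun_zero_left, add_assoc]
  have hrest : ‖∑ a ∈ (B.erase 0).erase b, expFun a t‖ + 2 ≤ B.card := by
    have hcard : ((B.erase 0).erase b).card + 2 = B.card := by
      rw [← Finset.card_erase_add_one hB, ← Finset.card_erase_add_one hbB]
    rw [← hcard]
    push_cast
    gcongr
    simpa using norm_sum_le ((B.erase 0).erase b) fun a => expFun a t
  have htwo : 2 ≤ ‖1 + expFun b t‖ := by
    have := norm_add_le (1 + expFun b t) (∑ a ∈ (B.erase 0).erase b, expFun a t)
    rw [← hsplit, hsum] at this
    linarith
  have hpar := parallelogram_law_with_norm ℝ 1 (expFun b t)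
  rw [norm_one, norm_expFun] at hpar
  have hdiff : ‖1 - expFun b t‖ = 0 := by
    nlinarith [norm_nonneg (1 - expFun b t)]
  exact expFun_eq_one_iff.1 (sub_eq_zero.1 (norm_eq_zero.1 hdiff)).symm

lemma finite_dualLattice_abs_le {b : ℤ} (hb : b ∈ B) (hb0 : b ≠ 0) (r : ℝ) :
    {t | t ∈ dualLattice B ∧ |t| ≤ r}.Finite := by
  have hb0' : (b : ℝ) ≠ 0 := by exact_mod_cast hb0
  refine ((Set.finite_Icc (-⌈|(b : ℝ)| * r⌉) ⌈|(b : ℝ)| * r⌉).image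
    fun k : ℤ => (k : ℝ) / b).subset ?_
  rintro t ⟨ht, htr⟩
  obtain ⟨k, hk⟩ := ht b hb
  refine ⟨k, abs_le.1 ?_, by simp only [← hk, mul_div_cancel_left₀ _ hb0']⟩
  have : |(k : ℝ)| ≤ ⌈|(b : ℝ)| * r⌉ := by
    rw [← hk, abs_mul]
    exact (mul_le_mul_of_nonneg_left htr (abs_nonneg _)).trans (Int.le_ceil _)
  exact_mod_cast this

end DualLattice

/-! ### Hadamard triples -/

/-- `(R, B, {l_i})` is a Hadamard triple: the matrix `N^{-1/2} (e^{2π i R⁻¹ b l_i})` is unitary.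
The normalization `0 ∈ B`, `0 ∈ {l_i}` is part of the notion, and both halves of unitarity are
recorded because rows and columns have different index types. -/
structure IsHadamardTriple {N : ℕ} (R : ℤ) (B : Finset ℤ) (l : Fin N → ℤ) : Prop where
  one_lt_abs : 1 < |R|
  zero_mem : (0 : ℤ) ∈ B
  card_eq : B.card = N
  exists_eq_zero : ∃ i, l i = 0
  mul_conjTranspose : hadamardMatrix R B l * (hadamardMatrix R B l).conjTranspose = 1
  conjTranspose_mul : (hadamardMatrix R B l).conjTranspose * hadamardMatrix R B l = 1

lemma hadamardMatrix_apply {N : ℕ} (R : ℤ) (B : Finset ℤ) (l : Fin N → ℤ) (i : Fin N) (b : B) :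
    hadamardMatrix R B l i b = (1 / (Real.sqrt N : ℂ)) * expFun (b : ℤ) (l i / R) := by
  unfold hadamardMatrix expFun
  congr 2
  push_cast
  ring

lemma one_div_sqrt_mul_self (N : ℕ) :
    (1 / (Real.sqrt N : ℂ)) * (1 / (Real.sqrt N : ℂ)) = 1 / N := by
  rw [div_mul_div_comm, one_mul, ← Complex.ofReal_mul, Real.mul_self_sqrt (Nat.cast_nonneg N),
    Complex.ofReal_natCast]

lemma intCast_ne_zero_of_one_lt_abs {R : ℤ} (hR : 1 < |R|) : (R : ℝ) ≠ 0 :=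
  Int.cast_ne_zero.2 (abs_pos.1 (one_pos.trans hR))

lemma abs_tau_le {R : ℤ} (hR : 1 < |R|) (b : ℤ) (x : ℝ) : |tau R b x| ≤ (|x| + |(b : ℝ)|) / 2 := by
  have hR2 : (2 : ℝ) ≤ |(R : ℝ)| := by exact_mod_cast hR
  rw [tau, abs_div]
  exact div_le_div₀ (by positivity) (abs_add_le x b) two_pos hR2

lemma mul_g {N : ℕ} {R : ℤ} {l : Fin N → ℤ} (hR : (R : ℝ) ≠ 0) (i : Fin N) (t : ℝ) :
    l i + R * g R l i t = t := by
  rw [g, mul_div_cancel₀ _ hR, add_sub_cancel]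

lemma g_add_mul {N : ℕ} {R : ℤ} {l : Fin N → ℤ} (hR : (R : ℝ) ≠ 0) (i j : Fin N) (t : ℝ) :
    g R l i (l j + R * t) = ((l j : ℝ) - l i) / R + t := by
  unfold g
  field_simp
  ring

namespace IsHadamardTriple

variable {N : ℕ} {R : ℤ} {B : Finset ℤ} {l : Fin N → ℤ}

lemma nonempty (h : IsHadamardTriple R B l) : B.Nonempty := ⟨0, h.zero_mem⟩

lemma cast_ne_zero (h : IsHadamardTriple R B l) : (R : ℝ) ≠ 0 :=
  intCast_ne_zero_of_one_lt_abs h.one_lt_abs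

lemma mB_sub_div (h : IsHadamardTriple R B l) (i j : Fin N) :
    mB B (((l i : ℝ) - l j) / R) = if i = j then 1 else 0 := by
  rw [← Matrix.one_apply, ← h.mul_conjTranspose, Matrix.mul_apply, mB, h.card_eq,
    ← Finset.sum_coe_sort B, Finset.mul_sum]
  refine Finset.sum_congr rfl fun b _ => ?_
  rw [Matrix.conjTranspose_apply, hadamardMatrix_apply, hadamardMatrix_apply,
    ← starRingEnd_apply, map_mul, map_div₀, map_one, Complex.conj_ofReal, conj_expFun_right,
    mul_mul_mul_comm, one_div_sqrt_mul_self, ← expFun_add_right, ← sub_eq_add_neg, sub_div]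

lemma nu_add_mul (h : IsHadamardTriple R B l) {t : ℝ} (ht : t ∈ dualLattice B) (i j : Fin N) :
    nu R B l i (l j + R * t) = if i = j then 1 else 0 := by
  rw [nu, g_add_mul h.cast_ne_zero, mB_add_of_mem ht, h.mB_sub_div]
  simp only [eq_comm]

lemma eq_of_sub_div_mem (h : IsHadamardTriple R B l) {i j : Fin N}
    (hij : ((l i : ℝ) - l j) / R ∈ dualLattice B) : i = j := by
  by_contra hne
  have := h.mB_sub_div i j
  rw [mB_of_mem h.nonempty hij, if_neg hne] at this
  exact one_ne_zero this

lemma conj_nu_eq (h : IsHadamardTriple R B l) (i : Fin N) (t : ℝ) :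
    conj (nu R B l i t) = (1 / (Real.sqrt N : ℂ)) *
      (hadamardMatrix R B l).mulVec (fun b => expFun (b : ℤ) (-(t / R))) i := by
  rw [nu, mB, h.card_eq, map_mul, map_sum, Matrix.mulVec, dotProduct, ← Finset.sum_coe_sort B,
    map_div₀, map_one, Complex.conj_natCast, ← one_div_sqrt_mul_self, mul_assoc, Finset.mul_sum]
  congr 1
  refine Finset.sum_congr rfl fun b _ => ?_
  rw [hadamardMatrix_apply, mul_assoc, ← expFun_add_right, conj_expFun_right, g]
  congr 2
  ring

/-- Parseval's identity for the unitary Hadamard matrix. -/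
lemma sum_conj_nu_mul_nu (h : IsHadamardTriple R B l) (s t : ℝ) :
    ∑ i, conj (nu R B l i s) * nu R B l i t = mB B ((t - s) / R) := by
  set H := hadamardMatrix R B l
  let w : ℝ → B → ℂ := fun t b => expFun (b : ℤ) (-(t / R))
  have hisometry : star (H.mulVec (w t)) ⬝ᵥ H.mulVec (w s) = star (w t) ⬝ᵥ w s := by
    rw [Matrix.star_mulVec, Matrix.dotProduct_mulVec, Matrix.vecMul_vecMul, h.conjTranspose_mul,
      Matrix.vecMul_one]
  calc ∑ i, conj (nu R B l i s) * nu R B l i t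
      = 1 / N * (star (H.mulVec (w t)) ⬝ᵥ H.mulVec (w s)) := by
        rw [dotProduct, Finset.mul_sum]
        refine Finset.sum_congr rfl fun i _ => ?_
        rw [← Complex.conj_conj (nu R B l i t), h.conj_nu_eq, h.conj_nu_eq, map_mul, map_div₀,
          map_one, Complex.conj_ofReal, mul_mul_mul_comm, one_div_sqrt_mul_self, Pi.star_apply,
          ← starRingEnd_apply, mul_comm (conj _)]
    _ = mB B ((t - s) / R) := by
        rw [hisometry, mB, h.card_eq, dotProduct, ← Finset.sum_coe_sort B]
        congr 1
        refine Finset.sum_congr rfl fun b _ => ?_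
        rw [Pi.star_apply, ← starRingEnd_apply, conj_expFun_right, ← expFun_add_right]
        congr 1
        ring

lemma sum_norm_nu_sq (h : IsHadamardTriple R B l) (t : ℝ) : ∑ i, ‖nu R B l i t‖ ^ 2 = 1 := by
  have := h.sum_conj_nu_mul_nu t t
  simp only [sub_self, zero_div, mB_zero h.nonempty, Complex.conj_mul'] at this
  exact_mod_cast this

lemma exists_nu_ne_zero (h : IsHadamardTriple R B l) (t : ℝ) : ∃ i, nu R B l i t ≠ 0 := by
  by_contra! hzero
  simpa [hzero] using h.sum_norm_nu_sq t

end IsHadamardTriple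
/-! ### Words and frequencies -/

section Words

variable {N : ℕ} {R : ℤ} {B : Finset ℤ} {l : Fin N → ℤ} {c d t : ℝ} {ω γ : List (Fin N)}

lemma gWord_append (ω γ : List (Fin N)) (t : ℝ) :
    gWord R l (ω ++ γ) t = gWord R l γ (gWord R l ω t) := by
  induction ω generalizing t with
  | nil => rfl
  | cons _ _ ih => exact ih _

lemma nuWord_append (ω γ : List (Fin N)) (t : ℝ) :
    nuWord R B l (ω ++ γ) t = nuWord R B l ω t * nuWord R B l γ (gWord R l ω t) := by
  induction ω generalizing t with
  | nil => simp [nuWord, gWord]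
  | cons i ω ih => simp [nuWord, gWord, ih, mul_assoc]

@[simp] lemma freq_nil (c : ℝ) : freq R l c [] = c := by simp [freq]

lemma freq_cons (c : ℝ) (i : Fin N) (ω : List (Fin N)) :
    freq R l c (i :: ω) = l i + R * freq R l c ω := by
  simp only [freq, List.length_cons, Fin.sum_univ_succ, List.get_eq_getElem, Fin.val_zero,
    pow_zero, one_mul, Fin.val_succ, List.getElem_cons_zero, List.getElem_cons_succ, mul_add,
    Finset.mul_sum, pow_succ', mul_assoc, add_assoc]

lemma freq_append (c : ℝ) (ω γ : List (Fin N)) :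
    freq R l c (ω ++ γ) = freq R l (freq R l c γ) ω := by
  induction ω with
  | nil => simp
  | cons i ω ih => simp [freq_cons, ih]

lemma exists_freq_eq_intCast_add (c : ℝ) (ω : List (Fin N)) :
    ∃ k : ℤ, freq R l c ω = k + (R : ℝ) ^ ω.length * c :=
  ⟨∑ k : Fin ω.length, R ^ (k : ℕ) * l (ω.get k), by rw [freq]; push_cast; rfl⟩

lemma freq_gWord (hR : (R : ℝ) ≠ 0) (ω : List (Fin N)) (t : ℝ) :
    freq R l (gWord R l ω t) ω = t := by
  induction ω generalizing t with
  | nil => simp [gWord]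
  | cons i ω ih => rw [freq_cons, gWord, ih, mul_g hR]

lemma gWord_freq (hR : (R : ℝ) ≠ 0) (ω : List (Fin N)) (t : ℝ) :
    gWord R l ω (freq R l t ω) = t := by
  induction ω with
  | nil => simp [gWord]
  | cons i ω ih => rw [freq_cons, gWord, g_add_mul hR, sub_self, zero_div, zero_add, ih]

lemma freq_mem_dualLattice (hc : c ∈ dualLattice B) (ω : List (Fin N)) :
    freq R l c ω ∈ dualLattice B := by
  obtain ⟨k, hk⟩ := exists_freq_eq_intCast_add (R := R) (l := l) c ω
  rw [hk, ← Int.cast_pow]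
  exact add_mem (intCast_mem_dualLattice k) (intCast_mul_mem_dualLattice _ hc)

lemma IsHadamardTriple.nuWord_freq (h : IsHadamardTriple R B l) (hc : c ∈ dualLattice B)
    (ω : List (Fin N)) : nuWord R B l ω (freq R l c ω) = 1 := by
  induction ω with
  | nil => rfl
  | cons i ω ih =>
    rw [freq_cons, nuWord, h.nu_add_mul (freq_mem_dualLattice hc ω), if_pos rfl,
      g_add_mul h.cast_ne_zero, sub_self, zero_div, zero_add, ih, one_mul]

lemma IsHadamardTriple.add_mul_inj (h : IsHadamardTriple R B l) {i j : Fin N} {s t : ℝ}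
    (hs : s ∈ dualLattice B) (ht : t ∈ dualLattice B) (heq : l i + R * s = l j + R * t) :
    i = j ∧ s = t := by
  have hR := h.cast_ne_zero
  have hij : i = j := h.eq_of_sub_div_mem <| by
    rw [show ((l i : ℝ) - l j) / R = t - s by field_simp; linear_combination heq]
    exact sub_mem ht hs
  subst hij
  exact ⟨rfl, mul_left_cancel₀ hR (add_left_cancel heq)⟩

lemma IsHadamardTriple.exists_append_of_freq_eq (h : IsHadamardTriple R B l)
    (hc : c ∈ dualLattice B) (hd : d ∈ dualLattice B) {ω₁ ω₂ : List (Fin N)}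
    (heq : freq R l c ω₁ = freq R l d ω₂) :
    (∃ γ, ω₂ = ω₁ ++ γ ∧ c = freq R l d γ) ∨ (∃ γ, ω₁ = ω₂ ++ γ ∧ d = freq R l c γ) := by
  induction ω₁ generalizing ω₂ with
  | nil => exact .inl ⟨ω₂, rfl, by simpa using heq⟩
  | cons i ω₁ ih =>
    cases ω₂ with
    | nil => exact .inr ⟨i :: ω₁, rfl, by simpa using heq.symm⟩
    | cons j ω₂ =>
      rw [freq_cons, freq_cons] at heq
      obtain ⟨rfl, htail⟩ :=
        h.add_mul_inj (freq_mem_dualLattice hc ω₁) (freq_mem_dualLattice hd ω₂) heq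
      simpa using ih htail

lemma exists_isCycleWord_suffix (hne : ω ≠ []) (hg : gWord R l ω c = c)
    (hν : nuWord R B l ω c ≠ 0) : ∃ β, IsCycleWord R B l c β ∧ β <:+ ω := by
  induction hn : ω.length using Nat.strong_induction_on generalizing ω with
  | _ n ih =>
    by_cases hprim : ∀ γ : List (Fin N), γ <+: ω → γ ≠ [] → γ ≠ ω → gWord R l γ c ≠ c
    · exact ⟨ω, ⟨hne, hg, hprim, hν⟩, List.suffix_rfl⟩
    push Not at hprim
    obtain ⟨γ, ⟨δ, rfl⟩, hγ0, hγω, hγ⟩ := hprim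
    have hδ : δ ≠ [] := by
      rintro rfl
      simp at hγω
    have hlen : δ.length < n := by
      have := List.length_pos_iff.2 hγ0
      rw [← hn, List.length_append]
      lia
    rw [gWord_append, hγ] at hg
    rw [nuWord_append, hγ] at hν
    obtain ⟨β, hβ, hs⟩ := ih _ hlen hδ hg (right_ne_zero_of_mul hν) rfl
    exact ⟨β, hβ, hs.trans (List.suffix_append _ _)⟩

/-- Removing cycle words from the end of a word does not change its frequency. -/
lemma exists_mem_OmegaZero_freq_eq (hR : (R : ℝ) ≠ 0) (c : ℝ) (ω : List (Fin N)) :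
    ∃ γ ∈ OmegaZero R B l c, freq R l c γ = freq R l c ω := by
  induction hn : ω.length using Nat.strong_induction_on generalizing ω with
  | _ n ih =>
    by_cases hω : ω ∈ OmegaZero R B l c
    · exact ⟨ω, hω, rfl⟩
    simp only [OmegaZero, Set.mem_ofPred_eq, not_forall, not_not] at hω
    obtain ⟨β, hβ, δ, rfl⟩ := hω
    have hlen : δ.length < n := by
      have := List.length_pos_iff.2 hβ.1
      rw [← hn, List.length_append]
      lia
    obtain ⟨γ, hγ, hfreq⟩ := ih _ hlen δ rfl
    have hβc : freq R l c β = c := by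
      conv_lhs => rw [← hβ.2.1, freq_gWord hR]
    exact ⟨γ, hγ, by rw [hfreq, freq_append, hβc]⟩

lemma eq_nil_of_append_mem_OmegaZero (hω : ω ++ γ ∈ OmegaZero R B l c)
    (hg : gWord R l γ c = c) (hν : nuWord R B l γ c ≠ 0) : γ = [] := by
  by_contra hne
  obtain ⟨β, hβ, hsuffix⟩ := exists_isCycleWord_suffix hne hg hν
  exact hω β hβ (hsuffix.trans (List.suffix_append _ _))

lemma IsInvariant.gWord_mem {M : Set ℝ} (hM : IsInvariant R B l M) (ht : t ∈ M)
    (hω : nuWord R B l ω t ≠ 0) : gWord R l ω t ∈ M := by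
  induction ω generalizing t with
  | nil => exact ht
  | cons i ω ih => exact ih (hM t ht i (left_ne_zero_of_mul hω)) (right_ne_zero_of_mul hω)

lemma isInvariant_orbit (t : ℝ) :
    IsInvariant R B l {s | ∃ ω, nuWord R B l ω t ≠ 0 ∧ gWord R l ω t = s} := by
  rintro s ⟨ω, hω, rfl⟩ i hi
  refine ⟨ω ++ [i], ?_, by simp [gWord_append, gWord]⟩
  simpa [nuWord_append, nuWord] using ⟨hω, hi⟩

end Words

/-! ### Minimal invariant sets -/

section MinimalInvariant

variable {N : ℕ} {R : ℤ} {B : Finset ℤ} {l : Fin N → ℤ} {M : Set ℝ} {s t : ℝ}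

namespace IsMinimalInvariant

lemma isInvariant (hM : IsMinimalInvariant R B l M) : IsInvariant R B l M := hM.prop.2

lemma exists_word (hM : IsMinimalInvariant R B l M) (hs : s ∈ M) (ht : t ∈ M) :
    ∃ ω, nuWord R B l ω s ≠ 0 ∧ gWord R l ω s = t := by
  refine hM.le_of_le (y := {s' | ∃ ω, nuWord R B l ω s ≠ 0 ∧ gWord R l ω s = s'})
    ⟨⟨s, [], one_ne_zero, rfl⟩, isInvariant_orbit s⟩ ?_ ht
  rintro _ ⟨ω, hω, rfl⟩
  exact hM.isInvariant.gWord_mem hs hω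

lemma eq_of_mem {M' : Set ℝ} (hM : IsMinimalInvariant R B l M)
    (hM' : IsMinimalInvariant R B l M') (ht : t ∈ M) (ht' : t ∈ M') : M = M' := by
  have hinter : (M ∩ M').Nonempty ∧ IsInvariant R B l (M ∩ M') :=
    ⟨⟨t, ht, ht'⟩, fun s hs i hi => ⟨hM.isInvariant s hs.1 i hi, hM'.isInvariant s hs.2 i hi⟩⟩
  exact Set.Subset.antisymm
    ((hM.le_of_le hinter Set.inter_subset_left).trans Set.inter_subset_right)
    ((hM'.le_of_le hinter Set.inter_subset_right).trans Set.inter_subset_left)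

lemma exists_loop (hM : IsMinimalInvariant R B l M) (h : IsHadamardTriple R B l) (ht : t ∈ M) :
    ∃ ω, ω ≠ [] ∧ nuWord R B l ω t ≠ 0 ∧ gWord R l ω t = t := by
  obtain ⟨i, hi⟩ := h.exists_nu_ne_zero t
  obtain ⟨ω, hω, hg⟩ := hM.exists_word (hM.isInvariant t ht i hi) ht
  exact ⟨i :: ω, List.cons_ne_nil _ _, mul_ne_zero hi hω, hg⟩

lemma exists_denominator (hM : IsMinimalInvariant R B l M) (h : IsHadamardTriple R B l) :
    ∃ n : ℕ, ∀ s ∈ M, ∃ k : ℤ, ((R : ℝ) ^ (n + 1) - 1) * s = k := by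
  obtain ⟨t, ht⟩ := hM.prop.1
  obtain ⟨ω, hne, -, hω⟩ := hM.exists_loop h ht
  obtain ⟨n, hn⟩ := Nat.exists_eq_succ_of_ne_zero (List.length_pos_iff.2 hne).ne'
  have hloop := freq_gWord h.cast_ne_zero ω t (l := l)
  obtain ⟨k, hk⟩ := exists_freq_eq_intCast_add t ω (R := R) (l := l)
  rw [hω, hk, hn, Nat.succ_eq_add_one] at hloop
  refine ⟨n, fun s hs => ?_⟩
  obtain ⟨γ, -, hγ⟩ := hM.exists_word hs ht
  have hpath := freq_gWord h.cast_ne_zero γ s (l := l)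
  obtain ⟨m, hm⟩ := exists_freq_eq_intCast_add t γ (R := R) (l := l)
  rw [hγ, hm] at hpath
  refine ⟨(R ^ (n + 1) - 1) * m - R ^ γ.length * k, ?_⟩
  push_cast
  linear_combination -((R : ℝ) ^ (n + 1) - 1) * hpath + (R : ℝ) ^ γ.length * hloop

/-- The difference of two successors of `t` is an integer, because its denominator divides both
`R` and `R ^ (n + 1) - 1`. -/
lemma nu_unique (hM : IsMinimalInvariant R B l M) (h : IsHadamardTriple R B l) (ht : t ∈ M)
    {i j : Fin N} (hi : nu R B l i t ≠ 0) (hj : nu R B l j t ≠ 0) : i = j := by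
  obtain ⟨n, hden⟩ := hM.exists_denominator h
  obtain ⟨k, hk⟩ := hden _ (hM.isInvariant t ht i hi)
  obtain ⟨m, hm⟩ := hden _ (hM.isInvariant t ht j hj)
  have hR := h.cast_ne_zero
  have hdiff : ((l i : ℝ) - l j) / R = (R ^ n * (l i - l j) + k - m : ℤ) := by
    unfold g at hk hm
    push_cast
    rw [← hk, ← hm]
    field_simp
    ring
  exact h.eq_of_sub_div_mem (hdiff ▸ intCast_mem_dualLattice _)

lemma subset_dualLattice (hM : IsMinimalInvariant R B l M) (h : IsHadamardTriple R B l) :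
    M ⊆ dualLattice B := by
  intro s hs
  obtain ⟨ω, hne, hν, hω⟩ := hM.exists_loop h hs
  obtain ⟨γ, i, rfl⟩ : ∃ γ i, ω = γ ++ [i] :=
    ⟨_, _, (List.dropLast_append_getLast hne).symm⟩
  rw [nuWord_append] at hν
  set t := gWord R l γ s
  have ht : t ∈ M := hM.isInvariant.gWord_mem hs (left_ne_zero_of_mul hν)
  have hi : nu R B l i t ≠ 0 := by simpa [nuWord] using right_ne_zero_of_mul hν
  have hits : g R l i t = s := by simpa [gWord_append, gWord] using hω
  have hnorm : ‖nu R B l i t‖ ^ 2 = 1 := by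
    rw [← h.sum_norm_nu_sq t, eq_comm]
    refine Finset.sum_eq_single i (fun j _ hji => ?_) (by simp)
    have hj : nu R B l j t = 0 := by_contra fun hj => hji (hM.nu_unique h ht hj hi)
    simp [hj]
  rw [nu, hits, pow_eq_one_iff_of_nonneg (norm_nonneg _) two_ne_zero] at hnorm
  exact mem_dualLattice_of_norm_mB_eq_one h.zero_mem hnorm

end IsMinimalInvariant

lemma exists_isMinimalInvariant_subset {Z : Set ℝ} (hfin : Z.Finite) (hne : Z.Nonempty)
    (hZ : IsInvariant R B l Z) : ∃ M ⊆ Z, IsMinimalInvariant R B l M := by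
  have hsub : {M | M ⊆ Z ∧ M.Nonempty ∧ IsInvariant R B l M}.Finite :=
    hfin.finite_subsets.subset fun M hM => hM.1
  obtain ⟨M, hMZ, hM⟩ := hsub.exists_le_minimal (a := Z) ⟨le_rfl, hne, hZ⟩
  exact ⟨M, hMZ, hM.prop.2, fun M' hM' hle => hM.le_of_le ⟨hle.trans hMZ, hM'⟩ hle⟩

/-- The union of the minimal invariant sets; these sets are the cycles of possible transitions. -/
def cyclePoints {N : ℕ} (R : ℤ) (B : Finset ℤ) (l : Fin N → ℤ) : Set ℝ :=
  {t | ∃ M, IsMinimalInvariant R B l M ∧ t ∈ M}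

lemma abs_g_le (hR : 1 < |R|) (i : Fin N) (t : ℝ) :
    |g R l i t| ≤ (|t| + ∑ j, |(l j : ℝ)|) / 2 := by
  have hl : |(l i : ℝ)| ≤ ∑ j, |(l j : ℝ)| :=
    Finset.single_le_sum (f := fun j => |(l j : ℝ)|) (fun _ _ => abs_nonneg _) (Finset.mem_univ i)
  calc |g R l i t| = |tau R (-l i) t| := by rw [g, tau, Int.cast_neg, sub_eq_add_neg]
    _ ≤ (|t| + |((-l i : ℤ) : ℝ)|) / 2 := abs_tau_le hR _ _
    _ ≤ (|t| + ∑ j, |(l j : ℝ)|) / 2 := by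
      rw [Int.cast_neg, abs_neg]
      gcongr

lemma abs_gWord_le (hR : 1 < |R|) (ω : List (Fin N)) (t : ℝ) :
    |gWord R l ω t| ≤ ∑ j, |(l j : ℝ)| + (|t| - ∑ j, |(l j : ℝ)|) / 2 ^ ω.length := by
  induction ω generalizing t with
  | nil => simp [gWord]
  | cons i ω ih =>
    refine (ih _).trans ?_
    rw [List.length_cons, pow_succ', ← div_div]
    gcongr
    linarith [abs_g_le hR i t (l := l)]

namespace IsHadamardTriple

lemma abs_le_of_mem_cyclePoints (h : IsHadamardTriple R B l) (ht : t ∈ cyclePoints R B l) :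
    |t| ≤ ∑ j, |(l j : ℝ)| := by
  obtain ⟨M, hM, htM⟩ := ht
  obtain ⟨ω, hne, -, hω⟩ := hM.exists_loop h htM
  have hbound := abs_gWord_le h.one_lt_abs ω t (l := l)
  rw [hω] at hbound
  by_contra! hlt
  have hpow : (1 : ℝ) < 2 ^ ω.length := one_lt_pow₀ one_lt_two (by simpa using hne)
  linarith [div_lt_self (sub_pos.2 hlt) hpow]

lemma cyclePoints_subset_dualLattice (h : IsHadamardTriple R B l) :
    cyclePoints R B l ⊆ dualLattice B := by
  rintro t ⟨M, hM, ht⟩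
  exact hM.subset_dualLattice h ht

lemma zero_mem_cyclePoints (h : IsHadamardTriple R B l) : (0 : ℝ) ∈ cyclePoints R B l := by
  obtain ⟨i, hi⟩ := h.exists_eq_zero
  have hinv : IsInvariant R B l {0} := by
    rintro t rfl j hj
    have hji := h.nu_add_mul (AddSubgroup.zero_mem (dualLattice B)) j i
    rw [hi, Int.cast_zero, mul_zero, add_zero] at hji
    obtain rfl : j = i := by_contra fun hne => hj (by rw [hji, if_neg hne])
    simp [g, hi]
  obtain ⟨M, hM0, hM⟩ :=
    exists_isMinimalInvariant_subset (Set.finite_singleton 0) (Set.singleton_nonempty 0) hinv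
  exact ⟨M, hM, hM.prop.1.subset_singleton_iff.1 hM0 ▸ rfl⟩

lemma exists_add_mul_eq_of_mem_cyclePoints (h : IsHadamardTriple R B l)
    (ht : t ∈ cyclePoints R B l) : ∃ i, ∃ s ∈ cyclePoints R B l, l i + R * s = t := by
  obtain ⟨M, hM, htM⟩ := ht
  obtain ⟨i, hi⟩ := h.exists_nu_ne_zero t
  exact ⟨i, _, ⟨M, hM, hM.isInvariant t htM i hi⟩, mul_g h.cast_ne_zero i t⟩

end IsHadamardTriple

/-! ### The spectrum -/

/-- The candidate spectrum: all frequencies of words based at points of minimal invariant sets. -/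
def cycleSpectrum {N : ℕ} (R : ℤ) (B : Finset ℤ) (l : Fin N → ℤ) : Set ℝ :=
  {t | ∃ c ∈ cyclePoints R B l, ∃ ω, freq R l c ω = t}

lemma cyclePoints_subset_cycleSpectrum : cyclePoints R B l ⊆ cycleSpectrum R B l :=
  fun c hc => ⟨c, hc, [], freq_nil c⟩

lemma add_mul_mem_cycleSpectrum (i : Fin N) (ht : t ∈ cycleSpectrum R B l) :
    l i + R * t ∈ cycleSpectrum R B l := by
  obtain ⟨c, hc, ω, rfl⟩ := ht
  exact ⟨c, hc, i :: ω, freq_cons c i ω⟩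

namespace IsHadamardTriple

lemma exists_add_mul_eq_of_mem_cycleSpectrum (h : IsHadamardTriple R B l)
    (ht : t ∈ cycleSpectrum R B l) : ∃ i, ∃ s ∈ cycleSpectrum R B l, l i + R * s = t := by
  obtain ⟨c, hc, _ | ⟨i, ω⟩, rfl⟩ := ht
  · obtain ⟨i, s, hs, rfl⟩ := h.exists_add_mul_eq_of_mem_cyclePoints hc
    exact ⟨i, s, cyclePoints_subset_cycleSpectrum hs, (freq_nil _).symm⟩
  · exact ⟨i, _, ⟨c, hc, ω, rfl⟩, (freq_cons c i ω).symm⟩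

lemma cycleSpectrum_subset_dualLattice (h : IsHadamardTriple R B l) :
    cycleSpectrum R B l ⊆ dualLattice B := by
  rintro _ ⟨c, hc, ω, rfl⟩
  exact freq_mem_dualLattice (h.cyclePoints_subset_dualLattice hc) ω

/-- If `B = {0}`, the dual lattice is not discrete, but then the spectrum is `{0}`. -/
lemma exists_discrete_addSubgroup_cycleSpectrum_subset (h : IsHadamardTriple R B l) :
    ∃ D : AddSubgroup ℝ, cycleSpectrum R B l ⊆ D ∧ ∀ r, {t | t ∈ D ∧ |t| ≤ r}.Finite := by
  by_cases hB : ∃ b ∈ B, b ≠ 0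
  · obtain ⟨b, hb, hb0⟩ := hB
    exact ⟨dualLattice B, h.cycleSpectrum_subset_dualLattice,
      finite_dualLattice_abs_le hb hb0⟩
  push Not at hB
  have hN : N = 1 := by
    rw [← h.card_eq, Finset.eq_singleton_iff_unique_mem.2 ⟨h.zero_mem, hB⟩,
      Finset.card_singleton]
  subst hN
  have hl : ∀ i, l i = 0 := fun i => by
    obtain ⟨j, hj⟩ := h.exists_eq_zero
    rw [Subsingleton.elim i j, hj]
  refine ⟨⊥, ?_, fun r => (Set.finite_singleton 0).subset fun t ht => ht.1⟩
  rintro _ ⟨c, hc, ω, rfl⟩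
  have hc0 : c = 0 := by simpa [hl] using h.abs_le_of_mem_cyclePoints hc
  simp [freq, hl, hc0]

lemma finite_cyclePoints (h : IsHadamardTriple R B l) : (cyclePoints R B l).Finite := by
  obtain ⟨D, hD, hfin⟩ := h.exists_discrete_addSubgroup_cycleSpectrum_subset
  exact (hfin _).subset fun t ht =>
    ⟨hD (cyclePoints_subset_cycleSpectrum ht), h.abs_le_of_mem_cyclePoints ht⟩

lemma finite_setOf_isMinimalInvariant (h : IsHadamardTriple R B l) :
    {M : Set ℝ | IsMinimalInvariant R B l M}.Finite :=
  h.finite_cyclePoints.finite_subsets.subset fun M hM _ ht => ⟨M, hM, ht⟩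

end IsHadamardTriple

end MinimalInvariant

section Reindexing

variable {N : ℕ} {R : ℤ} {B : Finset ℤ} {l : Fin N → ℤ}
  {c : {M : Set ℝ // IsMinimalInvariant R B l M} → ℝ}

namespace IsHadamardTriple

lemma exists_freq_eq_of_mem_cycleSpectrum (h : IsHadamardTriple R B l) (hc : ∀ M, c M ∈ M.1) {t : ℝ}
    (ht : t ∈ cycleSpectrum R B l) : ∃ M, ∃ ω ∈ OmegaZero R B l (c M), freq R l (c M) ω = t := by
  obtain ⟨d, ⟨M, hM, hd⟩, ω, rfl⟩ := ht
  obtain ⟨γ, -, hγ⟩ := hM.exists_word hd (hc ⟨M, hM⟩)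
  obtain ⟨δ, hδ, hfreq⟩ := exists_mem_OmegaZero_freq_eq h.cast_ne_zero (c ⟨M, hM⟩) (ω ++ γ)
    (B := B) (l := l)
  exact ⟨⟨M, hM⟩, δ, hδ, by rw [hfreq, freq_append, ← hγ, freq_gWord h.cast_ne_zero]⟩

/-- The word `γ` leads from `c M` to `c M'`, so both points lie in the same minimal set, hence
coincide, and `γ` is a loop. -/
lemma sigma_eq_of_append (h : IsHadamardTriple R B l) (hc : ∀ M, c M ∈ M.1)
    {M M' : {M : Set ℝ // IsMinimalInvariant R B l M}} {γ : List (Fin N)}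
    (ω : OmegaZero R B l (c M)) (ω' : OmegaZero R B l (c M')) (happ : ω'.1 = ω.1 ++ γ)
    (hγ : c M = freq R l (c M') γ) :
    (⟨M, ω⟩ : Σ M, OmegaZero R B l (c M)) = ⟨M', ω'⟩ := by
  have hg : gWord R l γ (c M) = c M' := by rw [hγ, gWord_freq h.cast_ne_zero]
  have hν : nuWord R B l γ (c M) ≠ 0 := by
    rw [hγ, h.nuWord_freq (M'.2.subset_dualLattice h (hc M'))]
    exact one_ne_zero
  obtain rfl : M = M' := Subtype.ext <|
    M.2.eq_of_mem M'.2 (hg ▸ M.2.isInvariant.gWord_mem (hc M) hν) (hc M')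
  have hnil : γ = [] := eq_nil_of_append_mem_OmegaZero (happ ▸ ω'.2) hg hν
  rw [hnil, List.append_nil] at happ
  rw [Subtype.ext happ]

lemma injective_freq (h : IsHadamardTriple R B l) (hc : ∀ M, c M ∈ M.1) :
    Function.Injective fun p : (Σ M, OmegaZero R B l (c M)) => freq R l (c p.1) p.2 := by
  rintro ⟨M, ω⟩ ⟨M', ω'⟩ heq
  rcases h.exists_append_of_freq_eq (M.2.subset_dualLattice h (hc M))
    (M'.2.subset_dualLattice h (hc M')) heq with ⟨γ, happ, hγ⟩ | ⟨γ, happ, hγ⟩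
  · exact h.sigma_eq_of_append hc ω ω' happ hγ
  · exact (h.sigma_eq_of_append hc ω' ω happ hγ).symm

lemma range_freq (h : IsHadamardTriple R B l) (hc : ∀ M, c M ∈ M.1) :
    Set.range (fun p : (Σ M, OmegaZero R B l (c M)) => freq R l (c p.1) p.2) =
      cycleSpectrum R B l := by
  refine Set.Subset.antisymm ?_ fun t ht => ?_
  · rintro _ ⟨p, rfl⟩
    exact ⟨c p.1, ⟨p.1.1, p.1.2, hc p.1⟩, p.2, rfl⟩
  · obtain ⟨M, ω, hω, rfl⟩ := h.exists_freq_eq_of_mem_cycleSpectrum hc ht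
    exact ⟨⟨M, ω, hω⟩, rfl⟩

end IsHadamardTriple

end Reindexing

/-! ### Invariant measures -/

namespace IsInvariantMeasure

variable {R : ℤ} {B : Finset ℤ} {μ : Measure ℝ}

lemma integral_expFun (h : IsInvariantMeasure R B μ) (t : ℝ) :
    ∫ x, expFun t x ∂μ = mB B (t / R) * ∫ x, expFun (t / R) x ∂μ := by
  rw [h.integral_eq (expFun t) (continuous_expFun t).measurable ⟨1, fun x => (norm_expFun t x).le⟩,
    mB, mul_assoc, Finset.sum_mul]
  congr 1
  refine Finset.sum_congr rfl fun b _ => ?_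
  rw [← integral_const_mul]
  congr 1 with x
  rw [expFun_comm b, ← expFun_add_right, tau, expFun_eq_fourierChar, expFun_eq_fourierChar]
  congr 2
  ring

lemma integral_eq_of_real (h : IsInvariantMeasure R B μ) {f : ℝ → ℝ} (hf : Measurable f) {C : ℝ}
    (hC : ∀ x, |f x| ≤ C) :
    ∫ x, f x ∂μ = (1 / (B.card : ℝ)) * ∑ b ∈ B, ∫ x, f (tau R b x) ∂μ := by
  have hcomplex := h.integral_eq (fun x => (f x : ℂ)) (Complex.measurable_ofReal.comp hf)
    ⟨C, fun x => by simpa using hC x⟩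
  simp only [integral_complex_ofReal] at hcomplex
  apply Complex.ofReal_injective
  rw [hcomplex]
  push_cast
  rfl

lemma comp_tau_ae_eq (h : IsInvariantMeasure R B μ) {f : ℝ → ℝ} (hf : Measurable f) {C : ℝ}
    (hC : ∀ x, |f x| ≤ C) (hle : ∀ b ∈ B, ∀ x, f (tau R b x) ≤ f x) {b : ℤ} (hb : b ∈ B) :
    (fun x => f (tau R b x)) =ᵐ[μ] f := by
  have := h.isProbabilityMeasure
  have hint : Integrable f μ := .of_bound hf.aestronglyMeasurable C (.of_forall hC)
  have hintτ : ∀ a, Integrable (fun x => f (tau R a x)) μ := fun a =>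
    .of_bound (hf.comp (measurable_tau R a)).aestronglyMeasurable C (.of_forall fun x => hC _)
  have hmono : ∀ a ∈ B, ∫ x, f (tau R a x) ∂μ ≤ ∫ x, f x ∂μ := fun a ha =>
    integral_mono (hintτ a) hint (hle a ha)
  have hsum : ∑ a ∈ B, ∫ x, f (tau R a x) ∂μ = ∑ _a ∈ B, ∫ x, f x ∂μ := by
    have hN : (B.card : ℝ) ≠ 0 := by exact_mod_cast (Finset.card_pos.2 ⟨b, hb⟩).ne'
    rw [Finset.sum_const, nsmul_eq_mul, h.integral_eq_of_real hf hC, ← mul_assoc,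
      mul_one_div_cancel hN, one_mul]
  exact (integral_eq_iff_of_ae_le (hintτ b) hint (.of_forall (hle b hb))).1
    ((Finset.sum_eq_sum_iff_of_le hmono).1 hsum b hb)

/-- The function `arctan (max |x| L)` decreases along the system, strictly where `L < |x|`. -/
lemma ae_abs_le (h : IsInvariantMeasure R B μ) (hR : 1 < |R|) (hB : B.Nonempty) :
    ∀ᵐ x ∂μ, |x| ≤ ∑ b ∈ B, |(b : ℝ)| := by
  set L := ∑ b ∈ B, |(b : ℝ)|
  have hτ : ∀ b ∈ B, ∀ x, |tau R b x| ≤ (|x| + L) / 2 := fun b hb x => by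
    refine (abs_tau_le hR b x).trans ?_
    gcongr
    exact Finset.single_le_sum (f := fun b : ℤ => |(b : ℝ)|) (fun _ _ => abs_nonneg _) hb
  have hdec : ∀ b ∈ B, ∀ x, max |tau R b x| L ≤ max |x| L := fun b hb x =>
    max_le (by linarith [hτ b hb x, le_max_left |x| L, le_max_right |x| L]) (le_max_right _ _)
  obtain ⟨b, hb⟩ := hB
  have hae := h.comp_tau_ae_eq (f := fun x => Real.arctan (max |x| L)) (by fun_prop)
    (fun x => (abs_lt.2 ⟨Real.neg_pi_div_two_lt_arctan _, Real.arctan_lt_pi_div_two _⟩).le)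
    (fun b hb x => Real.arctan_strictMono.monotone (hdec b hb x)) hb
  filter_upwards [hae] with x hx
  by_contra! hlt
  have heq : max |tau R b x| L = |x| := by
    rw [Real.arctan_injective hx, max_eq_left hlt.le]
  have : max |tau R b x| L < |x| := max_lt (by linarith [hτ b hb x]) hlt
  exact this.ne heq

end IsInvariantMeasure

/-! ### Exponentials in `L²` -/

section FourierUniqueness

variable {μ : Measure ℝ} {f : ℝ → ℂ}

lemma integrable_expFun_mul (t : ℝ) (hf : Integrable f μ) :
    Integrable (fun x => expFun t x * f x) μ :=
  hf.bdd_mul (c := 1) (continuous_expFun t).aestronglyMeasurable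
    (.of_forall fun x => (norm_expFun t x).le)

lemma charFun_withDensity_ofReal {v : ℝ → ℝ} (hv : AEMeasurable v μ) (hv0 : ∀ x, 0 ≤ v x) (t : ℝ) :
    charFun (μ.withDensity fun x => ENNReal.ofReal (v x)) t =
      ∫ x, expFun (t / (2 * Real.pi)) x * v x ∂μ := by
  rw [charFun_apply_real, integral_withDensity_eq_integral_toReal_smul₀ hv.ennreal_ofReal
    (.of_forall fun _ => ENNReal.ofReal_lt_top)]
  congr 1 with x
  rw [ENNReal.toReal_ofReal (hv0 x), Complex.real_smul, mul_comm, expFun]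
  congr 2
  have := Real.pi_ne_zero
  push_cast
  field_simp

lemma ae_eq_of_integral_expFun_mul_eq {v w : ℝ → ℝ} (hv : Integrable v μ) (hw : Integrable w μ)
    (hv0 : ∀ x, 0 ≤ v x) (hw0 : ∀ x, 0 ≤ w x)
    (h : ∀ t, ∫ x, expFun t x * v x ∂μ = ∫ x, expFun t x * w x ∂μ) : v =ᵐ[μ] w := by
  have := isFiniteMeasure_withDensity_ofReal hv.2
  have := isFiniteMeasure_withDensity_ofReal hw.2
  have hmeasure : (μ.withDensity fun x => ENNReal.ofReal (v x)) =
      μ.withDensity fun x => ENNReal.ofReal (w x) := by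
    refine Measure.ext_of_charFun (funext fun t => ?_)
    rw [charFun_withDensity_ofReal hv.aemeasurable hv0,
      charFun_withDensity_ofReal hw.aemeasurable hw0, h]
  rw [withDensity_eq_iff hv.aemeasurable.ennreal_ofReal hw.aemeasurable.ennreal_ofReal
    hv.lintegral_lt_top.ne] at hmeasure
  filter_upwards [hmeasure] with x hx
  rwa [ENNReal.ofReal_eq_ofReal_iff (hv0 x) (hw0 x)] at hx

lemma re_ae_eq_zero_of_integral_expFun_mul_eq_zero (hf : Integrable f μ)
    (h : ∀ t, ∫ x, expFun t x * f x ∂μ = 0) : (fun x => (f x).re) =ᵐ[μ] 0 := by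
  have hfc : Integrable (fun x => conj (f x)) μ :=
    Complex.conjCLE.toContinuousLinearMap.integrable_comp hf
  have hconj : ∀ t, ∫ x, expFun t x * conj (f x) ∂μ = 0 := fun t => by
    rw [← map_zero conj, ← h (-t), ← integral_conj]
    simp only [map_mul, conj_expFun_left, neg_neg]
  have hre : ∀ t, ∫ x, expFun t x * (f x).re ∂μ = 0 := fun t => by
    simp only [Complex.re_eq_add_conj, mul_div_assoc', mul_add]
    rw [integral_div, integral_add (integrable_expFun_mul t hf) (integrable_expFun_mul t hfc), h,
      hconj, add_zero, zero_div]
  have hae : (fun x => ‖f x‖ + (f x).re) =ᵐ[μ] fun x => ‖f x‖ := by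
    refine ae_eq_of_integral_expFun_mul_eq (hf.norm.add hf.re) hf.norm (fun x => ?_)
      (fun x => norm_nonneg _) fun t => ?_
    · linarith [neg_abs_le (f x).re, Complex.abs_re_le_norm (f x)]
    · simp only [Complex.ofReal_add, mul_add]
      have hadd := integral_add (integrable_expFun_mul t hf.norm.ofReal)
        (integrable_expFun_mul t hf.re.ofReal)
      exact hadd.trans (add_eq_left.2 (hre t))
  filter_upwards [hae] with x hx
  exact add_eq_left.1 hx

lemma ae_eq_zero_of_integral_expFun_mul_eq_zero (hf : Integrable f μ)
    (h : ∀ t, ∫ x, expFun t x * f x ∂μ = 0) : f =ᵐ[μ] 0 := by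
  have hre := re_ae_eq_zero_of_integral_expFun_mul_eq_zero hf h
  have him := re_ae_eq_zero_of_integral_expFun_mul_eq_zero (hf.const_mul Complex.I) fun t => by
    simp only [mul_left_comm _ Complex.I, integral_const_mul, h, mul_zero]
  filter_upwards [hre, him] with x hxre hxim
  exact Complex.ext hxre (by simpa using hxim)

end FourierUniqueness

/-- The exponential `e_t` as a bounded continuous function. -/
def expBCF (t : ℝ) : BoundedContinuousFunction ℝ ℂ :=
  BoundedContinuousFunction.ofNormedAddCommGroup (expFun t) (continuous_expFun t) 1
    fun x => (norm_expFun t x).le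

@[simp] lemma expBCF_apply (t x : ℝ) : expBCF t x = expFun t x := rfl

/-- The exponential `e_t` as an element of `L²(μ)`. -/
def expLp (μ : Measure ℝ) [IsFiniteMeasure μ] (t : ℝ) : Lp ℂ 2 μ :=
  BoundedContinuousFunction.toLp 2 μ ℂ (expBCF t)

section ExpLp

variable {μ : Measure ℝ} [IsFiniteMeasure μ]

lemma coeFn_expLp (t : ℝ) : expLp μ t =ᵐ[μ] expFun t :=
  BoundedContinuousFunction.coeFn_toLp 2 μ ℂ (expBCF t)

lemma inner_expLp (s t : ℝ) : inner ℂ (expLp μ s) (expLp μ t) = ∫ x, expFun (t - s) x ∂μ := by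
  rw [expLp, expLp, BoundedContinuousFunction.inner_toLp]
  simp only [expBCF_apply, conj_expFun_left, ← expFun_add_left, sub_eq_add_neg]

lemma topologicalClosure_span_expLp :
    (Submodule.span ℂ (Set.range (expLp μ))).topologicalClosure = ⊤ := by
  rw [Submodule.topologicalClosure_eq_top_iff, Submodule.eq_bot_iff]
  intro f hf
  have hint : Integrable f μ := (Lp.memLp f).integrable one_le_two
  refine Lp.ext (.trans ?_ (Lp.coeFn_zero _ _ _).symm)
  refine ae_eq_zero_of_integral_expFun_mul_eq_zero hint fun t => ?_
  have horth : inner ℂ (expLp μ (-t)) f = 0 :=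
    (Submodule.mem_orthogonal _ _).1 hf _ (Submodule.subset_span ⟨_, rfl⟩)
  rw [← horth, L2.inner_def]
  refine integral_congr_ae ?_
  filter_upwards [coeFn_expLp (μ := μ) (-t)] with x hx
  rw [hx, RCLike.inner_apply', conj_expFun_left, neg_neg]

lemma boundedContinuousFunction_exp_apply {α : Type*} [TopologicalSpace α]
    (f : BoundedContinuousFunction α ℂ) (x : α) : NormedSpace.exp f x = Complex.exp (f x) := by
  let ev : BoundedContinuousFunction α ℂ →+* ℂ :=
    { toFun := fun f => f x
      map_one' := rfl
      map_mul' := fun _ _ => rfl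
      map_zero' := rfl
      map_add' := fun _ _ => rfl }
  have hev : Continuous ev := (BoundedContinuousFunction.lipschitz_eval_const x).continuous
  rw [Complex.exp_eq_exp_ℂ]
  exact NormedSpace.map_exp ev hev f

/-- On `[-r, r]` the function `e_t` is `exp (t a)` for the bounded function `a(x) = 2π i x`
(truncated outside of `[-r, r]`), so `t ↦ e_t` inherits the regularity of the exponential series
in a Banach algebra. -/
lemma contDiff_expLp {r : ℝ} (hr : ∀ᵐ x ∂μ, |x| ≤ r) : ContDiff ℝ ⊤ (expLp μ) := by
  have hle : -|r| ≤ |r| := neg_le_self (abs_nonneg r)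
  let a : BoundedContinuousFunction ℝ ℂ := BoundedContinuousFunction.ofNormedAddCommGroup
    (fun x : ℝ => 2 * Real.pi * Complex.I * (Set.projIcc (-|r|) |r| hle x : ℝ))
    (by fun_prop) (2 * Real.pi * |r|) fun x => by
      have := abs_le.2 (Set.projIcc (-|r|) |r| hle x).2
      simp only [Complex.norm_mul, Complex.norm_ofNat, Complex.norm_real, Complex.norm_I,
        Real.norm_eq_abs, abs_of_pos Real.pi_pos, mul_one]
      gcongr
  have heq : expLp μ = fun t : ℝ => BoundedContinuousFunction.toLp 2 μ ℂ
      (NormedSpace.exp (t • a)) := by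
    funext t
    refine Lp.ext ?_
    filter_upwards [coeFn_expLp (μ := μ) t, BoundedContinuousFunction.coeFn_toLp 2 μ ℂ
      (NormedSpace.exp (t • a)), hr] with x hE hexp hx
    have hproj : (Set.projIcc (-|r|) |r| hle x : ℝ) = x := by
      rw [Set.projIcc_of_mem hle (abs_le.1 (hx.trans (le_abs_self r)))]
    rw [hE, hexp, boundedContinuousFunction_exp_apply, expFun, BoundedContinuousFunction.smul_apply,
      BoundedContinuousFunction.coe_ofNormedAddCommGroup, hproj, Complex.real_smul]
    ring_nf
  have hexp : ContDiff ℝ ⊤ (NormedSpace.exp : BoundedContinuousFunction ℝ ℂ → _) := by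
    rw [contDiff_omega_iff_analyticOnNhd]
    exact fun x _ => NormedSpace.exp_analytic (𝕂 := ℝ) x
  rw [heq]
  exact ((BoundedContinuousFunction.toLp 2 μ ℂ).restrictScalars ℝ).contDiff.comp
    (hexp.comp (contDiff_id.smul contDiff_const))

end ExpLp

/-! ### The maximum principle -/

section MaximumPrinciple

variable {N : ℕ} {R : ℤ} {B : Finset ℤ} {l : Fin N → ℤ}

namespace IsHadamardTriple

lemma isInvariant_setOf_eq_of_subharmonic (h : IsHadamardTriple R B l) {D : ℝ → ℝ} {S : Set ℝ}
    {m : ℝ} (hsub : ∀ t, D t ≤ ∑ i, ‖nu R B l i t‖ ^ 2 * D (g R l i t))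
    (hS : ∀ i, ∀ t ∈ S, g R l i t ∈ S) (hm : ∀ t ∈ S, D t ≤ m) :
    IsInvariant R B l {t | t ∈ S ∧ D t = m} := by
  rintro t ⟨ht, rfl⟩ i hi
  refine ⟨hS i t ht, (hm _ (hS i t ht)).antisymm ?_⟩
  by_contra! hlt
  have hsum : ∑ j, ‖nu R B l j t‖ ^ 2 * D (g R l j t) < ∑ j, ‖nu R B l j t‖ ^ 2 * D t :=
    Finset.sum_lt_sum (fun j _ => mul_le_mul_of_nonneg_left (hm _ (hS j t ht)) (sq_nonneg _))
      ⟨i, Finset.mem_univ i, mul_lt_mul_of_pos_left hlt (pow_pos (norm_pos_iff.2 hi) 2)⟩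
  rw [← Finset.sum_mul, h.sum_norm_nu_sq, one_mul] at hsum
  exact (hsum.trans_le' (hsub t)).false

/-- If a level set accumulates, then `D` is constant by analyticity, and `0` is a cycle point;
otherwise the points where `D` attains its maximum on `[-r, r]` form a finite invariant set. -/
lemma eq_zero_of_subharmonic (h : IsHadamardTriple R B l) {D : ℝ → ℝ} (hD : ContDiff ℝ ⊤ D)
    (hD0 : ∀ t, 0 ≤ D t) (hsub : ∀ t, D t ≤ ∑ i, ‖nu R B l i t‖ ^ 2 * D (g R l i t))
    (hcyc : ∀ c ∈ cyclePoints R B l, D c = 0) (t : ℝ) : D t = 0 := by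
  set L := ∑ j, |(l j : ℝ)|
  set r := max |t| L
  have htr : t ∈ Set.Icc (-r) r := abs_le.1 (le_max_left _ _)
  have hg : ∀ i, ∀ s ∈ Set.Icc (-r) r, g R l i s ∈ Set.Icc (-r) r := fun i s hs =>
    abs_le.1 (by linarith [abs_g_le h.one_lt_abs i s (l := l), abs_le.2 hs, le_max_right |t| L])
  obtain ⟨x, hx, hmax⟩ := isCompact_Icc.exists_isMaxOn ⟨t, htr⟩ hD.continuous.continuousOn
  suffices hDx : D x = 0 from ((hmax htr).trans_eq hDx).antisymm (hD0 t)
  rcases Set.finite_or_infinite {s | s ∈ Set.Icc (-r) r ∧ D s = D x} with hfin | hinf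
  · obtain ⟨M, hMsub, hM⟩ := exists_isMinimalInvariant_subset hfin ⟨x, hx, rfl⟩
      (h.isInvariant_setOf_eq_of_subharmonic hsub hg hmax)
    obtain ⟨c, hc⟩ := hM.prop.1
    rw [← (hMsub hc).2, hcyc c ⟨M, hM, hc⟩]
  · obtain ⟨z, -, hz⟩ := hinf.exists_accPt_of_subset_isCompact isCompact_Icc fun s hs => hs.1
    have hfreq : ∃ᶠ s in 𝓝[≠] z, D s = D x :=
      (accPt_iff_frequently_nhdsNE.1 hz).mono fun s hs => hs.2
    have hconst : D = fun _ => D x := AnalyticOnNhd.eq_of_frequently_eq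
      (contDiff_omega_iff_analyticOnNhd.1 hD) analyticOnNhd_const hfreq
    rw [← hcyc 0 h.zero_mem_cyclePoints, hconst]

end IsHadamardTriple

end MaximumPrinciple

/-! ### Transfer operators -/

section GramIsometry

variable {𝕜 ι H H' : Type*} [RCLike 𝕜] [NormedAddCommGroup H] [InnerProductSpace 𝕜 H]
  [NormedAddCommGroup H'] [InnerProductSpace 𝕜 H'] {E : ι → H} {F : ι → H'}

lemma norm_linearCombination_eq_of_inner_eq
    (hinner : ∀ s t, inner 𝕜 (F s) (F t) = inner 𝕜 (E s) (E t)) (v : ι →₀ 𝕜) :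
    ‖Finsupp.linearCombination 𝕜 F v‖ = ‖Finsupp.linearCombination 𝕜 E v‖ := by
  simp only [@norm_eq_sqrt_re_inner 𝕜, Finsupp.linearCombination_apply, Finsupp.sum_inner,
    Finsupp.inner_sum, inner_smul_left, inner_smul_right, hinner]

lemma exists_linearIsometry_of_inner_eq [CompleteSpace H']
    (hE : (Submodule.span 𝕜 (Set.range E)).topologicalClosure = ⊤)
    (hinner : ∀ s t, inner 𝕜 (F s) (F t) = inner 𝕜 (E s) (E t)) :
    ∃ V : H →ₗᵢ[𝕜] H', ∀ t, V (E t) = F t := by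
  set e := Finsupp.linearCombination 𝕜 E
  set f := Finsupp.linearCombination 𝕜 F
  have hnorm : ∀ v, ‖f v‖ = ‖e v‖ := norm_linearCombination_eq_of_inner_eq hinner
  have hdense : DenseRange e := by
    rw [DenseRange, ← LinearMap.coe_range, Finsupp.range_linearCombination,
      Submodule.dense_iff_topologicalClosure_eq_top, hE]
  have hV : ∀ v, f.extendOfNorm e (e v) = f v :=
    LinearMap.extendOfNorm_eq hdense ⟨1, fun v => by rw [one_mul, hnorm]⟩
  refine ⟨⟨(f.extendOfNorm e).toLinearMap, fun x => ?_⟩, fun t => ?_⟩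
  · refine hdense.induction_on x (isClosed_eq (by fun_prop) (by fun_prop)) fun v => ?_
    rw [ContinuousLinearMap.coe_coe, hV, hnorm]
  · have hVt := hV (Finsupp.single t 1)
    rwa [Finsupp.linearCombination_single, Finsupp.linearCombination_single, one_smul,
      one_smul] at hVt

end GramIsometry

section Transfer

variable {N : ℕ} {R : ℤ} {B : Finset ℤ} {l : Fin N → ℤ} {μ : Measure ℝ} [IsFiniteMeasure μ]
  {T : Fin N → Lp ℂ 2 μ →L[ℂ] Lp ℂ 2 μ} {s t : ℝ}

/-- The transfer operators `T_i e_t = ν_i(t) e_{g_i(t)}`. The second field says that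
`f ↦ (T_0 f, …, T_{N-1} f)` is an isometry, i.e. `∑ T_i* T_i = 1`. -/
structure IsTransferFamily (R : ℤ) (B : Finset ℤ) (l : Fin N → ℤ)
    (T : Fin N → Lp ℂ 2 μ →L[ℂ] Lp ℂ 2 μ) : Prop where
  apply_expLp : ∀ i t, T i (expLp μ t) = nu R B l i t • expLp μ (g R l i t)
  sum_inner : ∀ f₁ f₂, ∑ i, inner ℂ (T i f₁) (T i f₂) = inner ℂ f₁ f₂

lemma IsHadamardTriple.exists_isTransferFamily (h : IsHadamardTriple R B l)
    (hμ : IsInvariantMeasure R B μ) :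
    ∃ T : Fin N → Lp ℂ 2 μ →L[ℂ] Lp ℂ 2 μ, IsTransferFamily R B l T := by
  let F : ℝ → PiLp 2 fun _ : Fin N => Lp ℂ 2 μ := fun t =>
    WithLp.toLp 2 fun i => nu R B l i t • expLp μ (g R l i t)
  have hF : ∀ s t, inner ℂ (F s) (F t) = inner ℂ (expLp μ s) (expLp μ t) := fun s t => by
    have hg : ∀ i, g R l i t - g R l i s = (t - s) / R := fun i => by unfold g; ring
    simp only [F, PiLp.inner_apply, inner_smul_left, inner_smul_right, inner_expLp, hg]
    simp only [← mul_assoc, ← Finset.sum_mul]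
    simp only [mul_comm (nu R B l _ t), h.sum_conj_nu_mul_nu, ← hμ.integral_expFun]
  obtain ⟨V, hV⟩ := exists_linearIsometry_of_inner_eq topologicalClosure_span_expLp hF
  refine ⟨fun i => (PiLp.proj 2 (fun _ : Fin N => Lp ℂ 2 μ) i : _ →L[ℂ] _).comp
    V.toContinuousLinearMap, ⟨fun i t => ?_, fun f₁ f₂ => ?_⟩⟩
  · exact congrArg (fun v : PiLp 2 _ => v i) (hV t)
  · rw [← V.inner_map_map, PiLp.inner_apply]
    rfl

namespace IsTransferFamily

lemma sum_norm_sq (hT : IsTransferFamily R B l T) (f : Lp ℂ 2 μ) :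
    ∑ i, ‖T i f‖ ^ 2 = ‖f‖ ^ 2 := by
  have := hT.sum_inner f f
  simp only [inner_self_eq_norm_sq_to_K] at this
  exact_mod_cast this

lemma apply_expLp_add_mul (hT : IsTransferFamily R B l T) (h : IsHadamardTriple R B l)
    (ht : t ∈ dualLattice B) (i j : Fin N) :
    T i (expLp μ (l j + R * t)) = if i = j then expLp μ t else 0 := by
  rw [hT.apply_expLp, h.nu_add_mul ht]
  split_ifs with hij
  · rw [hij, g_add_mul h.cast_ne_zero, sub_self, zero_div, zero_add, one_smul]
  · rw [zero_smul]

lemma inner_expLp_apply (hT : IsTransferFamily R B l T) (h : IsHadamardTriple R B l)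
    (ht : t ∈ dualLattice B) (i : Fin N) (f : Lp ℂ 2 μ) :
    inner ℂ (expLp μ t) (T i f) = inner ℂ (expLp μ (l i + R * t)) f := by
  have hsum : ∀ j ∈ Finset.univ, j ≠ i →
      inner ℂ (T j (expLp μ (l i + R * t))) (T j f) = 0 := fun j _ hji => by
    rw [hT.apply_expLp_add_mul h ht, if_neg hji, inner_zero_left]
  rw [← hT.sum_inner (expLp μ (l i + R * t)) f,
    Finset.sum_eq_single_of_mem i (Finset.mem_univ i) hsum, hT.apply_expLp_add_mul h ht, if_pos rfl]

lemma inner_expLp_add_mul (hT : IsTransferFamily R B l T) (h : IsHadamardTriple R B l)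
    (hs : s ∈ dualLattice B) (ht : t ∈ dualLattice B) (i j : Fin N) :
    inner ℂ (expLp μ (l i + R * s)) (expLp μ (l j + R * t)) =
      if i = j then inner ℂ (expLp μ s) (expLp μ t) else 0 := by
  rw [← hT.inner_expLp_apply h hs, hT.apply_expLp_add_mul h ht, apply_ite (inner ℂ _),
    inner_zero_right]

end IsTransferFamily

end Transfer

/-! ### The orthonormal basis -/

section Basis

variable {N : ℕ} {R : ℤ} {B : Finset ℤ} {l : Fin N → ℤ} {μ : Measure ℝ} [IsFiniteMeasure μ]
  {T : Fin N → Lp ℂ 2 μ →L[ℂ] Lp ℂ 2 μ} {f : Lp ℂ 2 μ} {s t : ℝ}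

lemma IsTransferFamily.exists_sub_eq_mul_sub_of_inner_ne_zero (hT : IsTransferFamily R B l T)
    (h : IsHadamardTriple R B l) (hs : s ∈ cycleSpectrum R B l) (ht : t ∈ cycleSpectrum R B l)
    (hinner : inner ℂ (expLp μ s) (expLp μ t) ≠ 0) :
    ∃ s' ∈ cycleSpectrum R B l, ∃ t' ∈ cycleSpectrum R B l,
      inner ℂ (expLp μ s') (expLp μ t') ≠ 0 ∧ t - s = R * (t' - s') := by
  obtain ⟨i, s, hs', rfl⟩ := h.exists_add_mul_eq_of_mem_cycleSpectrum hs
  obtain ⟨j, t, ht', rfl⟩ := h.exists_add_mul_eq_of_mem_cycleSpectrum ht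
  rw [hT.inner_expLp_add_mul h (h.cycleSpectrum_subset_dualLattice hs')
    (h.cycleSpectrum_subset_dualLattice ht')] at hinner
  obtain ⟨hij, hinner'⟩ := ite_ne_right_iff.1 hinner
  exact ⟨s, hs', t, ht', hinner', by rw [hij]; ring⟩

/-- The nonzero differences of frequencies with nonorthogonal exponentials lie in a discrete group,
so if there were any, one of them would be smallest; but dividing it by `R` gives another one. -/
lemma IsHadamardTriple.inner_expLp_eq_zero (h : IsHadamardTriple R B l)
    (hμ : IsInvariantMeasure R B μ) (hs : s ∈ cycleSpectrum R B l)
    (ht : t ∈ cycleSpectrum R B l) (hst : s ≠ t) : inner ℂ (expLp μ s) (expLp μ t) = 0 := by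
  obtain ⟨T, hT⟩ := h.exists_isTransferFamily hμ
  obtain ⟨D, hD, hfin⟩ := h.exists_discrete_addSubgroup_cycleSpectrum_subset
  have hR : (1 : ℝ) < |(R : ℝ)| := by exact_mod_cast h.one_lt_abs
  let bad : Set ℝ := {z | z ≠ 0 ∧ ∃ s ∈ cycleSpectrum R B l, ∃ t ∈ cycleSpectrum R B l,
    inner ℂ (expLp μ s) (expLp μ t) ≠ 0 ∧ t - s = z}
  have hbadD : bad ⊆ D := by
    rintro _ ⟨-, s, hs, t, ht, -, rfl⟩
    exact D.sub_mem (hD ht) (hD hs)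
  have hdescent : ∀ z ∈ bad, ∃ z' ∈ bad, |z'| < |z| := by
    rintro z ⟨hz0, s, hs, t, ht, hinner, rfl⟩
    obtain ⟨s', hs', t', ht', hinner', heq⟩ :=
      hT.exists_sub_eq_mul_sub_of_inner_ne_zero h hs ht hinner
    have hz'0 : t' - s' ≠ 0 := right_ne_zero_of_mul (heq ▸ hz0)
    refine ⟨t' - s', ⟨hz'0, s', hs', t', ht', hinner', rfl⟩, ?_⟩
    rw [heq, abs_mul]
    exact lt_mul_of_one_lt_left (abs_pos.2 hz'0) hR
  by_contra hinner
  obtain ⟨z, ⟨hz, hzle⟩, hmin⟩ := Set.exists_min_image {z | z ∈ bad ∧ |z| ≤ |t - s|} abs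
    ((hfin |t - s|).subset fun z hz => ⟨hbadD hz.1, hz.2⟩)
    ⟨t - s, ⟨sub_ne_zero.2 hst.symm, s, hs, t, ht, hinner, rfl⟩, le_rfl⟩
  obtain ⟨z', hz', hlt⟩ := hdescent z hz
  exact (hmin z' ⟨hz', hlt.le.trans hzle⟩).not_gt hlt

lemma IsHadamardTriple.orthonormal_expLp (h : IsHadamardTriple R B l)
    (hμ : IsInvariantMeasure R B μ) {ι : Type*} {φ : ι → ℝ} (hφ : Function.Injective φ)
    (hmem : ∀ i, φ i ∈ cycleSpectrum R B l) : Orthonormal ℂ fun i => expLp μ (φ i) := by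
  have := hμ.isProbabilityMeasure
  refine ⟨fun i => ?_, fun i j hij => h.inner_expLp_eq_zero hμ (hmem i) (hmem j) (hφ.ne hij)⟩
  rw [@norm_eq_sqrt_re_inner ℂ, inner_expLp]
  simp

/-- The closed linear span of the exponentials with frequencies in the spectrum. -/
def spectralSubspace {N : ℕ} (R : ℤ) (B : Finset ℤ) (l : Fin N → ℤ) (μ : Measure ℝ)
    [IsFiniteMeasure μ] : Submodule ℂ (Lp ℂ 2 μ) :=
  (Submodule.span ℂ (expLp μ '' cycleSpectrum R B l)).topologicalClosure

instance : CompleteSpace (spectralSubspace R B l μ) :=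
  (Submodule.isClosed_topologicalClosure _).completeSpace_coe

lemma expLp_mem_spectralSubspace (ht : t ∈ cycleSpectrum R B l) :
    expLp μ t ∈ spectralSubspace R B l μ :=
  Submodule.le_topologicalClosure _ (Submodule.subset_span ⟨t, ht, rfl⟩)

lemma spectralSubspace_le {K : Submodule ℂ (Lp ℂ 2 μ)} (hK : IsClosed (K : Set (Lp ℂ 2 μ)))
    (h : ∀ t ∈ cycleSpectrum R B l, expLp μ t ∈ K) : spectralSubspace R B l μ ≤ K :=
  Submodule.topologicalClosure_minimal _ (Submodule.span_le.2 (Set.image_subset_iff.2 h)) hK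

lemma mem_orthogonal_spectralSubspace_iff : f ∈ (spectralSubspace R B l μ)ᗮ ↔
    ∀ t ∈ cycleSpectrum R B l, inner ℂ (expLp μ t) f = 0 := by
  refine ⟨fun hf t ht => hf _ (expLp_mem_spectralSubspace ht), fun hf => ?_⟩
  rw [← Submodule.span_singleton_le_iff_mem, Submodule.le_orthogonal_iff_le_orthogonal]
  exact spectralSubspace_le (Submodule.isClosed_orthogonal _) fun t ht =>
    Submodule.mem_orthogonal_singleton_iff_inner_left.2 (hf t ht)

lemma orthogonal_starProjection_comm {𝕜 H : Type*} [RCLike 𝕜] [NormedAddCommGroup H]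
    [InnerProductSpace 𝕜 H] {K : Submodule 𝕜 H} [K.HasOrthogonalProjection] {A : H →L[𝕜] H}
    (hA : ∀ x ∈ K, A x ∈ K) (hA' : ∀ x ∈ Kᗮ, A x ∈ Kᗮ) (x : H) :
    Kᗮ.starProjection (A x) = A (Kᗮ.starProjection x) := by
  refine Submodule.eq_starProjection_of_mem_orthogonal
    (hA' _ (Submodule.starProjection_apply_mem _ x)) ?_
  rw [← map_sub, Submodule.orthogonal_orthogonal]
  refine hA _ ?_
  have := Submodule.sub_starProjection_mem_orthogonal (K := Kᗮ) x
  rwa [Submodule.orthogonal_orthogonal] at this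

namespace IsTransferFamily

lemma apply_mem_spectralSubspace (hT : IsTransferFamily R B l T) (h : IsHadamardTriple R B l)
    (i : Fin N) (hf : f ∈ spectralSubspace R B l μ) : T i f ∈ spectralSubspace R B l μ := by
  refine spectralSubspace_le (K := (spectralSubspace R B l μ).comap (T i).toLinearMap)
    ((Submodule.isClosed_topologicalClosure _).preimage (T i).continuous) (fun t ht => ?_) hf
  obtain ⟨j, s, hs, rfl⟩ := h.exists_add_mul_eq_of_mem_cycleSpectrum ht
  rw [Submodule.mem_comap, ContinuousLinearMap.coe_coe,
    hT.apply_expLp_add_mul h (h.cycleSpectrum_subset_dualLattice hs)]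
  split_ifs
  exacts [expLp_mem_spectralSubspace hs, Submodule.zero_mem _]

lemma apply_mem_orthogonal_spectralSubspace (hT : IsTransferFamily R B l T)
    (h : IsHadamardTriple R B l) (i : Fin N) (hf : f ∈ (spectralSubspace R B l μ)ᗮ) :
    T i f ∈ (spectralSubspace R B l μ)ᗮ := by
  rw [mem_orthogonal_spectralSubspace_iff] at hf ⊢
  intro t ht
  rw [hT.inner_expLp_apply h (h.cycleSpectrum_subset_dualLattice ht)]
  exact hf _ (add_mul_mem_cycleSpectrum i ht)

lemma norm_starProjection_expLp_sq (hT : IsTransferFamily R B l T) (h : IsHadamardTriple R B l)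
    (t : ℝ) : ‖(spectralSubspace R B l μ)ᗮ.starProjection (expLp μ t)‖ ^ 2 =
      ∑ i, ‖nu R B l i t‖ ^ 2 *
        ‖(spectralSubspace R B l μ)ᗮ.starProjection (expLp μ (g R l i t))‖ ^ 2 := by
  rw [← hT.sum_norm_sq]
  refine Finset.sum_congr rfl fun i _ => ?_
  rw [← orthogonal_starProjection_comm (fun _ => hT.apply_mem_spectralSubspace h i)
    (fun _ => hT.apply_mem_orthogonal_spectralSubspace h i), hT.apply_expLp, map_smul, norm_smul,
    mul_pow]

end IsTransferFamily

lemma IsHadamardTriple.spectralSubspace_eq_top (h : IsHadamardTriple R B l)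
    (hμ : IsInvariantMeasure R B μ) : spectralSubspace R B l μ = ⊤ := by
  obtain ⟨T, hT⟩ := h.exists_isTransferFamily hμ
  set K := spectralSubspace R B l μ
  have hmem : ∀ f, Kᗮ.starProjection f = 0 ↔ f ∈ K := fun f => by
    rw [Submodule.starProjection_apply_eq_zero_iff, Submodule.orthogonal_orthogonal]
  have hsmooth : ContDiff ℝ ⊤ fun t => ‖Kᗮ.starProjection (expLp μ t)‖ ^ 2 :=
    ((Kᗮ.starProjection.restrictScalars ℝ).contDiff.comp
      (contDiff_expLp (hμ.ae_abs_le h.one_lt_abs h.nonempty))).norm_sq ℂ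
  have hzero := h.eq_zero_of_subharmonic hsmooth (fun t => sq_nonneg _)
    (fun t => (hT.norm_starProjection_expLp_sq h t).le) fun c hc => by
      rw [(hmem _).2 (expLp_mem_spectralSubspace (cyclePoints_subset_cycleSpectrum hc)), norm_zero,
        zero_pow two_ne_zero]
  rw [eq_top_iff, ← topologicalClosure_span_expLp]
  refine Submodule.topologicalClosure_minimal _ (Submodule.span_le.2 ?_)
    (Submodule.isClosed_topologicalClosure _)
  rintro _ ⟨t, rfl⟩
  exact (hmem _).1 (norm_eq_zero.1 (pow_eq_zero_iff two_ne_zero |>.1 (hzero t)))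

end Basis

end

end FractalFourier

theorem corollary4p8 {N : ℕ} [NeZero N] (R : ℤ) (hR : 1 < |R|)
    (B : Finset ℤ) (hB0 : (0 : ℤ) ∈ B) (hBN : B.card = N)
    (l : Fin N → ℤ) (hl0 : l 0 = 0)
    (hU : hadamardMatrix R B l * (hadamardMatrix R B l).conjTranspose = 1 ∧
      (hadamardMatrix R B l).conjTranspose * hadamardMatrix R B l = 1)
    (c : {M : Set ℝ // IsMinimalInvariant R B l M} → ℝ) (hc : ∀ M, c M ∈ M.1) :
    {M : Set ℝ | IsMinimalInvariant R B l M}.Finite ∧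
    ∃ e : HilbertBasis (Σ M : {M : Set ℝ // IsMinimalInvariant R B l M}, OmegaZero R B l (c M))
        ℂ (Lp ℂ 2 (invariantMeasure R B)),
      ∀ p, e p =ᵐ[invariantMeasure R B] expFun (freq R l (c p.1) p.2) := by
  have h : IsHadamardTriple R B l := ⟨hR, hB0, hBN, ⟨0, hl0⟩, hU.1, hU.2⟩
  have hμ := isInvariantMeasure_invariantMeasure hR h.nonempty
  have := hμ.isProbabilityMeasure
  refine ⟨h.finite_setOf_isMinimalInvariant, ?_⟩
  have horth := h.orthonormal_expLp hμ (h.injective_freq hc) fun p => h.range_freq hc ▸ ⟨p, rfl⟩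
  refine ⟨HilbertBasis.mk horth ?_, fun p => ?_⟩
  · rw [← h.spectralSubspace_eq_top hμ, spectralSubspace, ← h.range_freq hc, ← Set.range_comp]
    rfl
  · rw [HilbertBasis.coe_mk]
    exact coeFn_expLp _
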